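/- Let $X$ be a Banach space over $\mathbb{T}\in\{\mathbb{R},\mathbb{C}\}$, let $\mathcal{L}(E)$ denote the bounded linear operators on a normed space $E$, and let $\mathcal D(\cdot)$ denote the domain of a linear operator. For $S:[0,\infty)\to\mathcal{L}(E)$ let $S'(0)$ be the linear operator $S'(0)\psi=\lim_{h\to0+}h^{-1}(S(h)\psi-S(0)\psi)$ (limit in the norm of $E$), whose domain is the set of all $\psi\in E$ for which the limit exists. Let $S^*:[0,\infty)\to\mathcal{L}(E^*)$ be defined by $S^*(s)=(S(s))^*$. A $C_0$-semigroup is a strongly continuous $T:[0,\infty)\to\mathcal L(X)$ with $T(0)=I$, $T(l+m)=T(l)T(m)$ and $\|T(s)\|\le Me^{as}$ for some constants $M>1$, $a\in\mathbb{R}$; its generator is $T'(0)$. Let $\mathcal{F}_X$ be the set of all functions $F:[0,\infty)\to\mathcal{L}(X)$ such that $F(0)=I$, the domain of $F'(0)$ is dense in $X$, and for some $M\ge 1$, $a\in\mathbb{R}$ one has $\|F(s/n)^m\|\le M\exp(ams/n)$ for all $n,m\in\mathbb{N}$, $n\geq 1$, and all $s\ge 0$. **Theorem.** Let $Z$ be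 a densely defined linear operator in $X$, let $t>0$, and let $F\in\mathcal{F}_X$ be such that (i) $\mathcal D(Z)\subseteq \mathcal D(F'(0))$ and $F'(0)f=Zf$ for all $f\in \mathcal D(Z)$; (ii) $\mathcal D((F^*)'(0))$ is weak-* dense in $X^*$. Then $Z$ is closable and its closure is the generator of a $C_0$-semigroup if and only if there is a linear subspace $A\subseteq \mathcal D(Z)$, dense in $X$, such that for all $f\in A$ and $s\ge0$ there is a sequence $(f_n^s)_{n}$ in $\mathcal D(Z)$ with the following properties, where $[ns]$ is the integer part of $ns$: (a) $\lim_{n\to\infty}\|F(t/n)^{[ns]}f-f_n^s\|=0$; (b) every subsequence of $(Zf_n^s)_{n}$ has a subsequence that converges weakly in $X$; (c) every subsequence of $(f_n^s)_{n}$ has a subsequence that converges weakly in $X$. -/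

import Mathlib

open Filter Topology
open scoped NNReal

namespace Chernoff

section

variable {𝕜 : Type*} [RCLike 𝕜] {E : Type*} [NormedAddCommGroup E] [NormedSpace 𝕜 E]

/-- `y` is the limit of `h⁻¹ (S h x - S 0 x)` in the norm of `E` as `h → 0`, `h > 0`. -/
def HasStrongDerivAtZero (S : ℝ≥0 → E →L[𝕜] E) (x y : E) : Prop :=
  Tendsto (fun h : ℝ≥0 => (((h : ℝ) : 𝕜))⁻¹ • (S h x - S 0 x)) (𝓝[>] (0 : ℝ≥0)) (𝓝 y)

theorem HasStrongDerivAtZero.unique {S : ℝ≥0 → E →L[𝕜] E} {x y z : E}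
    (hy : HasStrongDerivAtZero S x y) (hz : HasStrongDerivAtZero S x z) : y = z :=
  tendsto_nhds_unique hy hz

theorem HasStrongDerivAtZero.add {S : ℝ≥0 → E →L[𝕜] E} {x x' y y' : E}
    (h : HasStrongDerivAtZero S x y) (h' : HasStrongDerivAtZero S x' y') :
    HasStrongDerivAtZero S (x + x') (y + y') := by
  refine (Tendsto.add h h').congr fun t => ?_
  rw [← smul_add, map_add, map_add, add_sub_add_comm]

theorem HasStrongDerivAtZero.smul {S : ℝ≥0 → E →L[𝕜] E} {x y : E} (c : 𝕜)
    (h : HasStrongDerivAtZero S x y) : HasStrongDerivAtZero S (c • x) (c • y) := by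
  refine (Tendsto.const_smul h c).congr fun t => ?_
  rw [smul_comm, smul_sub, map_smul, map_smul]

theorem HasStrongDerivAtZero.zero (S : ℝ≥0 → E →L[𝕜] E) : HasStrongDerivAtZero S 0 0 := by
  simp [HasStrongDerivAtZero]

/-- The space of all `x` for which the limit of `h⁻¹ (S h x - S 0 x)` as `h → 0` exists. -/
def strongDerivDomain (S : ℝ≥0 → E →L[𝕜] E) : Submodule 𝕜 E where
  carrier := {x | ∃ y, HasStrongDerivAtZero S x y}
  add_mem' := fun ⟨_, h⟩ ⟨_, h'⟩ => ⟨_, h.add h'⟩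
  zero_mem' := ⟨0, HasStrongDerivAtZero.zero S⟩
  smul_mem' := fun c _ ⟨_, h⟩ => ⟨_, h.smul c⟩

/-- The strong derivative `S'(0)`, as a linear operator with its maximal domain. -/
noncomputable def strongDeriv (S : ℝ≥0 → E →L[𝕜] E) : E →ₗ.[𝕜] E where
  domain := strongDerivDomain S
  toFun :=
    { toFun := fun x => x.2.choose
      map_add' := fun x x' =>
        (x + x').2.choose_spec.unique (x.2.choose_spec.add x'.2.choose_spec)
      map_smul' := fun c x => (c • x).2.choose_spec.unique (x.2.choose_spec.smul c) }

theorem mem_strongDeriv_domain {S : ℝ≥0 → E →L[𝕜] E} {x : E} :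
    x ∈ (strongDeriv S).domain ↔ ∃ y, HasStrongDerivAtZero S x y :=
  Iff.rfl

theorem strongDeriv_spec (S : ℝ≥0 → E →L[𝕜] E) (x : (strongDeriv S).domain) :
    HasStrongDerivAtZero S x (strongDeriv S x) :=
  Exists.choose_spec (mem_strongDeriv_domain.1 x.2)

/-- The function `S^*` with `S^*(s) = (S(s))^*`, i.e. `S^*(s) φ = φ ∘ S(s)`. -/
noncomputable def dualFun (S : ℝ≥0 → E →L[𝕜] E) :
    ℝ≥0 → StrongDual 𝕜 E →L[𝕜] StrongDual 𝕜 E :=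
  fun s => ContinuousLinearMap.precomp 𝕜 (S s)

theorem dualFun_apply (S : ℝ≥0 → E →L[𝕜] E) (s : ℝ≥0) (φ : StrongDual 𝕜 E) (x : E) :
    dualFun S s φ x = φ (S s x) :=
  rfl

/-- The class of functions `F : [0,∞) → L(E)` with `F(0) = I`,
`‖F(s/n)^m‖ ≤ M exp(a m s / n)` and densely defined `F'(0)`, for given `M` and `a`. -/
structure MemClassF (M a : ℝ) (F : ℝ≥0 → E →L[𝕜] E) : Prop where
  map_zero : F 0 = 1
  norm_pow_le : ∀ n m : ℕ, 0 < n → ∀ s : ℝ≥0,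
    ‖F (s / (n : ℝ≥0)) ^ m‖ ≤ M * Real.exp (a * (m : ℝ) / (n : ℝ) * (s : ℝ))
  dense_domain : Dense ((strongDeriv F).domain : Set E)

/-- The union of the classes above over all `M ≥ 1` and `a ∈ ℝ`. -/
def ClassF (F : ℝ≥0 → E →L[𝕜] E) : Prop :=
  ∃ M a : ℝ, 1 ≤ M ∧ MemClassF M a F

/-- `T` is a `C₀`-semigroup. -/
structure IsC0Semigroup (T : ℝ≥0 → E →L[𝕜] E) : Prop where
  map_zero : T 0 = 1
  map_add : ∀ l m : ℝ≥0, T (l + m) = T l * T m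
  continuous_apply : ∀ x : E, Continuous fun s => T s x
  growth : ∃ M a : ℝ, 1 < M ∧ ∀ s : ℝ≥0, ‖T s‖ ≤ M * Real.exp (a * (s : ℝ))

/-- `Z` is the generator of some `C₀`-semigroup. -/
def IsC0Generator (Z : E →ₗ.[𝕜] E) : Prop :=
  ∃ T : ℝ≥0 → E →L[𝕜] E, IsC0Semigroup T ∧ Z = strongDeriv T

variable (𝕜) in
/-- Convergence of the sequence `u` to `x` in the weak topology of `E`. -/
def WeaklyTendsto (u : ℕ → E) (x : E) : Prop :=
  Tendsto (fun n => toWeakSpace 𝕜 E (u n)) atTop (𝓝 (toWeakSpace 𝕜 E x))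

variable (𝕜) in
/-- Every subsequence of `u` has a weakly convergent subsubsequence. -/
def WeaklySeqRelCompact (u : ℕ → E) : Prop :=
  ∀ p : ℕ → ℕ, StrictMono p → ∃ q : ℕ → ℕ, StrictMono q ∧
    ∃ x : E, WeaklyTendsto 𝕜 (fun k => u (p (q k))) x

/-- A set of functionals is dense in the weak-* topology of the dual space. -/
def WeakStarDense (D : Set (StrongDual 𝕜 E)) : Prop :=
  Dense (StrongDual.toWeakDual '' D : Set (WeakDual 𝕜 E))

end

end Chernoff

namespace Chernoff

section General

variable {𝕜 : Type*} [RCLike 𝕜] {X : Type*} [NormedAddCommGroup X] [NormedSpace 𝕜 X]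

theorem norm_apply_le_of_norm_le {T : X →L[𝕜] X} {C : ℝ} (h : ‖T‖ ≤ C) (x : X) :
    ‖T x‖ ≤ C * ‖x‖ :=
  (T.le_opNorm x).trans (mul_le_mul_of_nonneg_right h (norm_nonneg x))

/-- Strong convergence of uniformly bounded operators can be tested on a dense set. -/
theorem tendsto_of_tendsto_on_dense {ι : Type*} {l : Filter ι} {T : ι → X →L[𝕜] X}
    {T₀ : X →L[𝕜] X} {C : ℝ} (hT : ∀ᶠ i in l, ‖T i‖ ≤ C) {D : Set X} (hD : Dense D)
    (h : ∀ x ∈ D, Tendsto (fun i => T i x) l (𝓝 (T₀ x))) (x : X) :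
    Tendsto (fun i => T i x) l (𝓝 (T₀ x)) := by
  rw [Metric.tendsto_nhds]
  intro ε hε
  have hK : 0 < |C| + ‖T₀‖ + 1 := by positivity
  obtain ⟨y, hy, hyD⟩ := Metric.dense_iff.1 hD x (ε / 2 / (|C| + ‖T₀‖ + 1)) (by positivity)
  rw [Metric.mem_ball, dist_eq_norm, lt_div_iff₀ hK] at hy
  filter_upwards [hT, Metric.tendsto_nhds.1 (h y hyD) (ε / 2) (half_pos hε)] with i hi hi'
  rw [dist_eq_norm] at hi' ⊢
  have e : T i x - T₀ x = T₀ (y - x) - T i (y - x) + (T i y - T₀ y) := by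
    simp only [map_sub]; abel
  have h1 := T₀.le_opNorm (y - x)
  have h2 := norm_apply_le_of_norm_le (hi.trans (le_abs_self C)) (y - x)
  rw [e]
  have h3 := norm_add_le (T₀ (y - x) - T i (y - x)) (T i y - T₀ y)
  have h4 := norm_sub_le (T₀ (y - x)) (T i (y - x))
  have h5 := norm_nonneg (y - x)
  nlinarith

/-- Uniformly bounded operators applied to convergent vectors. -/
theorem tendsto_apply_of_tendsto {ι : Type*} {l : Filter ι} {T : ι → X →L[𝕜] X} {C : ℝ}
    (hT : ∀ᶠ i in l, ‖T i‖ ≤ C) {v : ι → X} {x y : X} (hv : Tendsto v l (𝓝 x))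
    (h : Tendsto (fun i => T i x) l (𝓝 y)) : Tendsto (fun i => T i (v i)) l (𝓝 y) := by
  have h0 : Tendsto (fun i => T i (v i - x)) l (𝓝 0) := by
    have h1 : Tendsto (fun i => C * ‖v i - x‖) l (𝓝 0) := by
      have := ((hv.sub_const x).norm).const_mul C
      simpa using this
    refine squeeze_zero_norm' ?_ h1
    filter_upwards [hT] with i hi
    exact norm_apply_le_of_norm_le hi _
  have := h0.add h
  simpa using this

/-- Uniformly bounded operators whose orbits are Cauchy on a dense set converge strongly. -/
theorem exists_tendsto_of_cauchySeq_on_dense [CompleteSpace X] {T : ℕ → X →L[𝕜] X} {C : ℝ}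
    (hT : ∀ n, ‖T n‖ ≤ C) {D : Set X} (hD : Dense D) (h : ∀ x ∈ D, CauchySeq fun n => T n x) :
    ∃ T₀ : X →L[𝕜] X, ∀ x, Tendsto (fun n => T n x) atTop (𝓝 (T₀ x)) := by
  have hc : ∀ x, CauchySeq fun n => T n x := by
    intro x
    rw [Metric.cauchySeq_iff']
    intro ε hε
    have hC : 0 ≤ C := (norm_nonneg _).trans (hT 0)
    obtain ⟨y, hy, hyD⟩ := Metric.dense_iff.1 hD x (ε / 3 / (C + 1)) (by positivity)
    rw [Metric.mem_ball, dist_eq_norm, lt_div_iff₀ (by positivity)] at hy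
    obtain ⟨N, hN⟩ := Metric.cauchySeq_iff'.1 (h y hyD) (ε / 3) (by positivity)
    refine ⟨N, fun n hn => ?_⟩
    have h1 := hN n hn
    rw [dist_eq_norm] at h1 ⊢
    have e : T n x - T N x = T N (y - x) - T n (y - x) + (T n y - T N y) := by
      simp only [map_sub]; abel
    rw [e]
    have h2 := norm_apply_le_of_norm_le (hT n) (y - x)
    have h2' := norm_apply_le_of_norm_le (hT N) (y - x)
    have h3 := norm_add_le (T N (y - x) - T n (y - x)) (T n y - T N y)
    have h4 := norm_sub_le (T N (y - x)) (T n (y - x))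
    have h5 := norm_nonneg (y - x)
    nlinarith
  choose f hf using fun x => cauchySeq_tendsto_of_complete (hc x)
  exact ⟨continuousLinearMapOfTendsto (σ₁₂ := RingHom.id 𝕜) T (tendsto_pi_nhds.2 hf), hf⟩

theorem norm_le_of_tendsto_apply {ι : Type*} {l : Filter ι} [l.NeBot] {T : ι → X →L[𝕜] X}
    {T₀ : X →L[𝕜] X} {C : ι → ℝ} {C₀ : ℝ} (hT : ∀ᶠ i in l, ‖T i‖ ≤ C i)
    (hC : Tendsto C l (𝓝 C₀))
    (h : ∀ x, Tendsto (fun i => T i x) l (𝓝 (T₀ x))) : ‖T₀‖ ≤ C₀ := by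
  have hC₀ : 0 ≤ C₀ := ge_of_tendsto hC (hT.mono fun i hi => (norm_nonneg _).trans hi)
  refine T₀.opNorm_le_bound hC₀ fun x => ?_
  exact le_of_tendsto_of_tendsto (h x).norm (hC.mul_const ‖x‖)
    (hT.mono fun i hi => norm_apply_le_of_norm_le hi x)

/-- A subspace whose annihilator is trivial is dense. -/
theorem dense_of_forall_dual_eq_zero {p : Submodule 𝕜 X}
    (h : ∀ χ : StrongDual 𝕜 X, (∀ x ∈ p, χ x = 0) → χ = 0) : Dense (p : Set X) := by
  rw [Submodule.dense_iff_topologicalClosure_eq_top, eq_top_iff]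
  intro x _
  by_contra hx
  have : IsClosed (p.topologicalClosure : Set X) := p.isClosed_topologicalClosure
  have hne : ‖(Submodule.Quotient.mk x : X ⧸ p.topologicalClosure)‖ ≠ 0 := by
    rw [norm_ne_zero_iff]
    exact fun h0 => hx ((Submodule.Quotient.mk_eq_zero _).1 h0)
  obtain ⟨g, -, hg⟩ := exists_dual_vector 𝕜 _ hne
  have h1 := h (g.comp p.topologicalClosure.mkQL) fun y hy => by
    have : (Submodule.Quotient.mk y : X ⧸ p.topologicalClosure) = 0 :=
      (Submodule.Quotient.mk_eq_zero _).2 (p.le_topologicalClosure hy)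
    simp [this]
  have h2 := DFunLike.congr_fun h1 x
  simp only [ContinuousLinearMap.comp_apply, Submodule.mkQL_apply, zero_apply] at h2
  rw [show p.topologicalClosure.mkQ x = Submodule.Quotient.mk x from rfl, hg] at h2
  exact hne (by exact_mod_cast h2)

end General

section DiscreteResolvent

variable {𝕜 : Type*} [RCLike 𝕜] {X : Type*} [NormedAddCommGroup X] [NormedSpace 𝕜 X]

variable (𝕜) in
theorem norm_ofReal_of_nonneg {r : ℝ} (h : 0 ≤ r) : ‖(r : 𝕜)‖ = r := by
  rw [RCLike.norm_ofReal, abs_of_nonneg h]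

/-- The difference quotient `h⁻¹ (P - 1)`. -/
noncomputable def diffQuot (P : X →L[𝕜] X) (h : ℝ) : X →L[𝕜] X :=
  ((h : 𝕜))⁻¹ • (P - 1)

/-- The resolvent of `diffQuot P h` at `r`, as a Neumann series. -/
noncomputable def discRes (P : X →L[𝕜] X) (h r : ℝ) : X →L[𝕜] X :=
  ((h * (1 + r * h)⁻¹ : ℝ) : 𝕜) • ∑' k : ℕ, ((((1 + r * h)⁻¹ : ℝ) : 𝕜) • P) ^ k

/-- `P` has powers growing at most like `M (1 + b h) ^ k`. -/
def PowBound (M b h : ℝ) (P : X →L[𝕜] X) : Prop := ∀ k : ℕ, ‖P ^ k‖ ≤ M * (1 + b * h) ^ k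

variable {P : X →L[𝕜] X} {M b h r : ℝ}

theorem diffQuot_apply (x : X) : diffQuot P h x = ((h : 𝕜))⁻¹ • (P x - x) := rfl

theorem PowBound.nonneg (hP : PowBound M b h P) : 0 ≤ M := by
  simpa using (norm_nonneg _).trans (hP 0)

theorem PowBound.norm_term_le (hP : PowBound M b h P) (hh : 0 < h) (hb : 0 ≤ b) (hr : b < r)
    (k : ℕ) :
    ‖((((1 + r * h)⁻¹ : ℝ) : 𝕜) • P) ^ k‖ ≤ M * ((1 + b * h) * (1 + r * h)⁻¹) ^ k := by
  have h1 : 0 < 1 + r * h := by nlinarith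
  rw [smul_pow, norm_smul, norm_pow, norm_ofReal_of_nonneg 𝕜 (inv_nonneg.2 h1.le), mul_pow]
  calc _ ≤ ((1 + r * h)⁻¹) ^ k * (M * (1 + b * h) ^ k) := by gcongr; exact hP k
    _ = _ := by ring

theorem ratio_lt_one (hh : 0 < h) (hb : 0 ≤ b) (hr : b < r) :
    (1 + b * h) * (1 + r * h)⁻¹ < 1 := by
  have h1 : 0 < 1 + r * h := by nlinarith
  rw [← div_eq_mul_inv, div_lt_one h1]
  nlinarith

theorem ratio_nonneg (hh : 0 < h) (hb : 0 ≤ b) (hr : b < r) :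
    0 ≤ (1 + b * h) * (1 + r * h)⁻¹ := by
  have h1 : 0 < 1 + r * h := by nlinarith
  positivity

theorem sub_diffQuot_eq (hh : 0 < h) (hr : 0 ≤ r) :
    (r : 𝕜) • (1 : X →L[𝕜] X) - diffQuot P h
      = ((h⁻¹ * (1 + r * h) : ℝ) : 𝕜) • (1 - (((1 + r * h)⁻¹ : ℝ) : 𝕜) • P) := by
  have h1 : 0 < 1 + r * h := by nlinarith
  rw [diffQuot, smul_sub, smul_sub, smul_smul, ← RCLike.ofReal_mul, mul_assoc,
    mul_inv_cancel₀ h1.ne', mul_one, mul_add, mul_one, mul_comm r h, ← mul_assoc,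
    inv_mul_cancel₀ hh.ne', one_mul, RCLike.ofReal_add, add_smul, RCLike.ofReal_inv]
  abel

theorem commute_discRes_of_commute {Q : X →L[𝕜] X} (hQ : Commute Q P) (h r : ℝ) :
    Commute Q (discRes P h r) := by
  refine Commute.smul_right (Commute.tsum_right _ fun k => ?_) _
  exact (hQ.smul_right _).pow_right k

variable [CompleteSpace X]

theorem PowBound.summable (hP : PowBound M b h P) (hh : 0 < h) (hb : 0 ≤ b) (hr : b < r) :
    Summable fun k : ℕ => ((((1 + r * h)⁻¹ : ℝ) : 𝕜) • P) ^ k :=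
  Summable.of_norm_bounded
    ((summable_geometric_of_lt_one (ratio_nonneg hh hb hr) (ratio_lt_one hh hb hr)).mul_left M)
    (hP.norm_term_le hh hb hr)

theorem discRes_mul (hP : PowBound M b h P) (hh : 0 < h) (hb : 0 ≤ b) (hr : b < r) :
    discRes P h r * ((r : 𝕜) • 1 - diffQuot P h) = 1 := by
  have h1 : 0 < 1 + r * h := by nlinarith
  rw [sub_diffQuot_eq hh (hb.trans hr.le), discRes, smul_mul_smul_comm,
    (hP.summable hh hb hr).tsum_pow_mul_one_sub, ← RCLike.ofReal_mul]
  rw [show h * (1 + r * h)⁻¹ * (h⁻¹ * (1 + r * h)) = 1 by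
    generalize 1 + r * h = d at h1; field_simp]
  simp

theorem mul_discRes (hP : PowBound M b h P) (hh : 0 < h) (hb : 0 ≤ b) (hr : b < r) :
    ((r : 𝕜) • 1 - diffQuot P h) * discRes P h r = 1 := by
  have h1 : 0 < 1 + r * h := by nlinarith
  rw [sub_diffQuot_eq hh (hb.trans hr.le), discRes, smul_mul_smul_comm,
    (hP.summable hh hb hr).one_sub_mul_tsum_pow, ← RCLike.ofReal_mul]
  rw [show (h⁻¹ * (1 + r * h)) * (h * (1 + r * h)⁻¹) = 1 by
    generalize 1 + r * h = d at h1; field_simp]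
  simp

theorem norm_pow_mul_discRes_pow_le (hP : PowBound M b h P) (hh : 0 < h) (hb : 0 ≤ b)
    (hr : b < r) (j k : ℕ) :
    ‖P ^ k * discRes P h r ^ j‖ ≤ M * (1 + b * h) ^ k / (r - b) ^ j := by
  have h1 : 0 < 1 + r * h := by nlinarith
  have h2 : 0 < r - b := sub_pos.2 hr
  have h3 : 0 ≤ M := hP.nonneg
  have h0 : 0 ≤ 1 + b * h := by positivity
  induction j generalizing k with
  | zero => simpa using hP k
  | succ j ih =>
    set c := (1 + r * h)⁻¹ with hc
    have hc0 : 0 < c := inv_pos.2 h1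
    have e : P ^ k * discRes P h r ^ (j + 1)
        = ((h * c : ℝ) : 𝕜) • ∑' i : ℕ, (((c : ℝ) : 𝕜) ^ i • (P ^ (k + i) * discRes P h r ^ j)) := by
      rw [pow_succ', ← mul_assoc]
      conv_lhs => rw [show P ^ k * discRes P h r = ((h * c : ℝ) : 𝕜) •
        ∑' i : ℕ, (((c : ℝ) : 𝕜) ^ i • P ^ (k + i)) from by
          rw [hc, discRes, mul_smul_comm, ← (hP.summable hh hb hr).tsum_mul_left]
          simp_rw [smul_pow, mul_smul_comm, pow_add]]
      rw [smul_mul_assoc]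
      congr 1
      have hs : Summable fun i : ℕ => (((c : ℝ) : 𝕜) ^ i • P ^ (k + i)) := by
        refine ((hP.summable hh hb hr).mul_left (P ^ k)).congr fun i => ?_
        rw [smul_pow, mul_smul_comm, pow_add]
      rw [← hs.tsum_mul_right]
      simp_rw [smul_mul_assoc]
    have hq0 := ratio_nonneg hh hb hr
    have hq1 := ratio_lt_one hh hb hr
    have hbound : ∀ i : ℕ, ‖(((c : ℝ) : 𝕜) ^ i • (P ^ (k + i) * discRes P h r ^ j))‖
        ≤ M * (1 + b * h) ^ k / (r - b) ^ j * ((1 + b * h) * c) ^ i := by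
      intro i
      rw [norm_smul, norm_pow, norm_ofReal_of_nonneg 𝕜 hc0.le]
      calc _ ≤ c ^ i * (M * (1 + b * h) ^ (k + i) / (r - b) ^ j) := by gcongr; exact ih _
        _ = _ := by rw [pow_add, mul_pow]; ring
    have := tsum_of_norm_bounded ((hasSum_geometric_of_lt_one hq0 hq1).mul_left _) hbound
    rw [e, norm_smul, norm_ofReal_of_nonneg 𝕜 (by positivity)]
    calc _ ≤ h * c * (M * (1 + b * h) ^ k / (r - b) ^ j * (1 - (1 + b * h) * c)⁻¹) := by gcongr
      _ = _ := by
        have : 1 - (1 + b * h) * c = (r - b) * h * c := by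
          have : (1 + r * h) * c = 1 := mul_inv_cancel₀ h1.ne'
          linear_combination -this
        rw [this, pow_succ]
        field_simp

theorem norm_discRes_pow_le (hP : PowBound M b h P) (hh : 0 < h) (hb : 0 ≤ b)
    (hr : b < r) (j : ℕ) : ‖discRes P h r ^ j‖ ≤ M / (r - b) ^ j := by
  simpa using norm_pow_mul_discRes_pow_le hP hh hb hr j 0

theorem norm_discRes_le (hP : PowBound M b h P) (hh : 0 < h) (hb : 0 ≤ b)
    (hr : b < r) : ‖discRes P h r‖ ≤ M / (r - b) := by
  simpa using norm_discRes_pow_le hP hh hb hr 1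

end DiscreteResolvent

section Binomial

variable {𝕜 : Type*} [RCLike 𝕜] {X : Type*} [NormedAddCommGroup X] [NormedSpace 𝕜 X]

theorem norm_smul_one_add_smul_pow_le {R : X →L[𝕜] X} {M q α β : ℝ} (hα : 0 ≤ α) (hβ : 0 ≤ β)
    (hR : ∀ i : ℕ, ‖R ^ i‖ ≤ M * q ^ i) (k : ℕ) :
    ‖((α : 𝕜) • (1 : X →L[𝕜] X) + (β : 𝕜) • R) ^ k‖ ≤ M * (α + β * q) ^ k := by
  have hc : Commute ((β : 𝕜) • R) ((α : 𝕜) • (1 : X →L[𝕜] X)) :=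
    ((Commute.one_right R).smul_right _).smul_left _
  rw [add_comm, hc.add_pow, add_comm α, add_pow, Finset.mul_sum]
  refine norm_sum_le_of_le _ fun i _ => ?_
  rw [smul_pow, smul_pow, one_pow, smul_mul_smul_comm, mul_one, ← nsmul_eq_mul',
    ← Nat.cast_smul_eq_nsmul 𝕜, norm_smul, RCLike.norm_natCast, norm_smul, norm_mul, norm_pow, norm_pow, norm_ofReal_of_nonneg 𝕜 hα,
    norm_ofReal_of_nonneg 𝕜 hβ]
  have h1 := hR i
  calc _ ≤ (k.choose i : ℝ) * (β ^ i * α ^ (k - i) * (M * q ^ i)) := by gcongr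
    _ = _ := by rw [mul_pow]; ring

/-- The bounded operator `m ^ 2 R - m`; for `R` the resolvent at `m` it is the Yosida
approximation. -/
noncomputable def yosida (R : X →L[𝕜] X) (m : ℝ) : X →L[𝕜] X :=
  ((m ^ 2 : ℝ) : 𝕜) • R - (m : 𝕜) • 1

theorem powBound_one_add_smul_yosida {R : X →L[𝕜] X} {M b m h : ℝ} (hb : 0 ≤ b) (hm : 0 < m)
    (hbm : 2 * b ≤ m) (hh : 0 ≤ h) (hhm : h * m ≤ 1)
    (hR : ∀ i : ℕ, ‖R ^ i‖ ≤ M / (m - b) ^ i) :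
    PowBound M (2 * b) h (1 + (h : 𝕜) • yosida R m) := by
  intro k
  have hmb : 0 < m - b := by linarith
  have hM : 0 ≤ M := by simpa using (norm_nonneg _).trans (hR 0)
  have e : (1 + (h : 𝕜) • yosida R m : X →L[𝕜] X)
      = ((1 - h * m : ℝ) : 𝕜) • (1 : X →L[𝕜] X) + ((h * m ^ 2 : ℝ) : 𝕜) • R := by
    rw [yosida, smul_sub, smul_smul, smul_smul]
    push_cast
    rw [sub_smul, one_smul]
    abel
  rw [e]
  refine (norm_smul_one_add_smul_pow_le (sub_nonneg.2 hhm) (by positivity)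
    (q := (m - b)⁻¹) (fun i => by simpa [div_eq_mul_inv] using hR i) k).trans ?_
  have h1 : 1 - h * m + h * m ^ 2 * (m - b)⁻¹ ≤ 1 + 2 * b * h := by
    rw [← div_eq_mul_inv, ← le_sub_iff_add_le', div_le_iff₀ hmb]
    nlinarith [mul_nonneg (mul_nonneg hh hb) (sub_nonneg.2 hbm)]
  have h2 : 0 ≤ 1 - h * m + h * m ^ 2 * (m - b)⁻¹ := by
    have := inv_pos.2 hmb
    have := sub_nonneg.2 hhm
    positivity
  gcongr

theorem one_add_smul_pow_apply (B : X →L[𝕜] X) (h : ℝ) (k : ℕ) (u : X) :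
    ((1 + (h : 𝕜) • B) ^ k) u
      = ∑ i ∈ Finset.range (k + 1), (((k.choose i : ℝ) * h ^ i : ℝ) : 𝕜) • (B ^ i) u := by
  have hc : Commute ((h : 𝕜) • B) (1 : X →L[𝕜] X) := Commute.one_right _
  rw [add_comm, hc.add_pow, sum_apply]
  refine Finset.sum_congr rfl fun i _ => ?_
  rw [one_pow, mul_one, ← nsmul_eq_mul', smul_pow, ← Nat.cast_smul_eq_nsmul 𝕜, smul_smul]
  push_cast
  rfl

theorem choose_mul_pow_le {k : ℕ} {h S : ℝ} (hh : 0 ≤ h) (hS : k * h ≤ S) (i : ℕ) :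
    (k.choose i : ℝ) * h ^ i ≤ S ^ i / (i.factorial : ℝ) := by
  have h1 : (k.choose i : ℝ) ≤ (k : ℝ) ^ i / (i.factorial : ℝ) := Nat.choose_le_pow_div i k
  calc _ ≤ (k : ℝ) ^ i / (i.factorial : ℝ) * h ^ i := by gcongr
    _ = (k * h) ^ i / (i.factorial : ℝ) := by rw [mul_pow]; ring
    _ ≤ _ := by gcongr

theorem summable_exp_weights {T B : X →L[𝕜] X} (S : ℝ) (hS : 0 ≤ S) (u : X) :
    Summable fun i : ℕ => S ^ i / (i.factorial : ℝ) * ‖T ((B ^ i) u)‖ := by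
  refine Summable.of_nonneg_of_le (fun i => by positivity) (fun i => ?_)
    ((Real.summable_pow_div_factorial (S * ‖B‖)).mul_right (‖T‖ * ‖u‖))
  have h1 : ‖T ((B ^ i) u)‖ ≤ ‖T‖ * (‖B‖ ^ i * ‖u‖) := by
    refine (T.le_opNorm _).trans ?_
    gcongr
    refine ((B ^ i).le_opNorm u).trans ?_
    gcongr
    rcases i with _ | i
    · rw [pow_zero, pow_zero]
      exact ContinuousLinearMap.norm_id_le
    · exact norm_pow_le' B i.succ_pos
  calc _ ≤ S ^ i / (i.factorial : ℝ) * (‖T‖ * (‖B‖ ^ i * ‖u‖)) := by gcongr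
    _ = _ := by rw [mul_pow]; ring

theorem norm_apply_one_add_smul_pow_le {T B : X →L[𝕜] X} {h S : ℝ} {k : ℕ} (hh : 0 ≤ h)
    (hS : k * h ≤ S) (u : X) :
    ‖T (((1 + (h : 𝕜) • B) ^ k) u)‖ ≤ ∑' i : ℕ, S ^ i / (i.factorial : ℝ) * ‖T ((B ^ i) u)‖ := by
  have hS0 : 0 ≤ S := le_trans (by positivity) hS
  rw [one_add_smul_pow_apply, map_sum]
  refine (norm_sum_le _ _).trans ((Finset.sum_le_sum fun i _ => ?_).trans
    ((summable_exp_weights S hS0 u).sum_le_tsum _ fun i _ => by positivity))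
  rw [map_smul, norm_smul, norm_ofReal_of_nonneg 𝕜 (by positivity)]
  gcongr
  exact choose_mul_pow_le hh hS i

theorem tendsto_tsum_exp_weights {T : ℕ → X →L[𝕜] X} {B : X →L[𝕜] X} {C S : ℝ} (hS : 0 ≤ S)
    (hT : ∀ n, ‖T n‖ ≤ C) (h : ∀ x, Tendsto (fun n => T n x) atTop (𝓝 0)) (u : X) :
    Tendsto (fun n => ∑' i : ℕ, S ^ i / (i.factorial : ℝ) * ‖T n ((B ^ i) u)‖) atTop (𝓝 0) := by
  have hC : 0 ≤ C := (norm_nonneg _).trans (hT 0)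
  have h1 : ∀ i : ℕ, Tendsto (fun n => S ^ i / (i.factorial : ℝ) * ‖T n ((B ^ i) u)‖) atTop
      (𝓝 0) := fun i => by
    simpa using (h ((B ^ i) u)).norm.const_mul (S ^ i / (i.factorial : ℝ))
  have h2 := summable_exp_weights (T := ((C : 𝕜) • 1 : X →L[𝕜] X)) (B := B) S hS u
  have := tendsto_tsum_of_dominated_convergence (𝓕 := atTop) h2 h1 <| Eventually.of_forall
    fun n i => by
      rw [Real.norm_of_nonneg (by positivity)]
      gcongr
      simp only [smul_apply, one_apply_eq_self, norm_smul,
        norm_ofReal_of_nonneg 𝕜 hC]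
      exact norm_apply_le_of_norm_le (hT n) _
  simpa using this

theorem tendsto_choose_mul_pow {k : ℕ → ℕ} {h : ℕ → ℝ} {s : ℝ} (hh : Tendsto h atTop (𝓝 0))
    (hk : Tendsto (fun n => k n * h n) atTop (𝓝 s)) (i : ℕ) :
    Tendsto (fun n => ((k n).choose i : ℝ) * h n ^ i) atTop (𝓝 (s ^ i / (i.factorial : ℝ))) := by
  induction i with
  | zero => simp
  | succ i ih =>
    have h1 := (ih.mul (hk.sub (hh.const_mul (i : ℝ)))).mul_const ((i + 1 : ℝ)⁻¹)
    rw [mul_zero, sub_zero] at h1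
    convert h1 using 2 with n
    · have h2 : ((k n).choose (i + 1) : ℝ) * (i + 1) = (k n).choose i * ((k n : ℝ) - i) := by
        rcases le_or_gt i (k n) with hi | hi
        · have := Nat.choose_succ_right_eq (k n) i
          rw [← Nat.cast_sub hi]
          exact_mod_cast this
        · simp [Nat.choose_eq_zero_of_lt hi, Nat.choose_eq_zero_of_lt (hi.trans i.lt_succ_self)]
      have h3 : (i + 1 : ℝ) ≠ 0 := by positivity
      rw [← div_eq_mul_inv, eq_div_iff h3, pow_succ]
      linear_combination (h n ^ i * h n) * h2
    · rw [Nat.factorial_succ]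
      push_cast
      rw [pow_succ]
      field_simp

theorem tendsto_one_add_smul_pow [CompleteSpace X] (B : X →L[𝕜] X) {k : ℕ → ℕ} {h : ℕ → ℝ} {s : ℝ}
    (hpos : ∀ n, 0 ≤ h n) (hh : Tendsto h atTop (𝓝 0))
    (hk : Tendsto (fun n => k n * h n) atTop (𝓝 s)) (u : X) :
    ∃ y, Tendsto (fun n => ((1 + (h n : 𝕜) • B) ^ k n) u) atTop (𝓝 y) := by
  obtain ⟨S, hS⟩ := hk.bddAbove_range
  have hS' : ∀ n, k n * h n ≤ S := fun n => hS ⟨n, rfl⟩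
  have hS0 : 0 ≤ S := le_trans (by have := hpos 0; positivity) (hS' 0)
  refine ⟨∑' i : ℕ, ((s ^ i / (i.factorial : ℝ) : ℝ) : 𝕜) • (B ^ i) u, ?_⟩
  have e : ∀ n, ((1 + (h n : 𝕜) • B) ^ k n) u
      = ∑' i : ℕ, ((((k n).choose i : ℝ) * h n ^ i : ℝ) : 𝕜) • (B ^ i) u := fun n => by
    rw [one_add_smul_pow_apply, tsum_eq_sum]
    intro i hi
    rw [Nat.choose_eq_zero_of_lt (by simpa using hi)]
    simp
  simp_rw [e]
  refine tendsto_tsum_of_dominated_convergence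
    (summable_exp_weights (T := (1 : X →L[𝕜] X)) (B := B) S hS0 u) (fun i => ?_)
    (Eventually.of_forall fun n i => ?_)
  · refine Tendsto.smul_const ?_ _
    exact (RCLike.continuous_ofReal.tendsto _).comp (tendsto_choose_mul_pow hh hk i)
  · have := hpos n
    rw [norm_smul, norm_ofReal_of_nonneg 𝕜 (by positivity)]
    gcongr
    · exact choose_mul_pow_le (hpos n) (hS' n) i
    · rfl

/-- Error propagation for `P ^ k * R - R * Q ^ k`. -/
theorem norm_pow_mul_sub_le {P Q R : X →L[𝕜] X} {K d : ℝ} {N : ℕ} {u : X}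
    (hK : ∀ i ≤ N, ‖P ^ i‖ ≤ K) (hd : ∀ j < N, ‖(P * R - R * Q) ((Q ^ j) u)‖ ≤ d) (k : ℕ)
    (m : ℕ) (hkm : m + k ≤ N) :
    ‖(P ^ m * (P ^ k * R - R * Q ^ k)) u‖ ≤ k * (K * d) := by
  have hK0 : 0 ≤ K := (norm_nonneg _).trans (hK 0 (Nat.zero_le _))
  induction k generalizing m with
  | zero => simp
  | succ k ih =>
    have e : P ^ m * (P ^ (k + 1) * R - R * Q ^ (k + 1))
        = P ^ (m + 1) * (P ^ k * R - R * Q ^ k) + P ^ m * ((P * R - R * Q) * Q ^ k) := by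
      rw [pow_succ' P k, pow_succ' Q k, pow_succ P m]
      noncomm_ring
    rw [e, add_apply]
    refine (norm_add_le _ _).trans ?_
    have h1 := ih (m + 1) (by omega)
    have h2 : ‖(P ^ m * ((P * R - R * Q) * Q ^ k)) u‖ ≤ K * d := by
      refine (norm_apply_le_of_norm_le (hK m (by omega)) _).trans ?_
      gcongr
      exact hd k (by omega)
    rw [Nat.cast_succ, add_mul, one_mul]
    exact add_le_add h1 h2

end Binomial

section System

variable {𝕜 : Type*} [RCLike 𝕜] {X : Type*} [NormedAddCommGroup X] [NormedSpace 𝕜 X]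

/-- Stable discrete semigroups `(F n) ^ k` with step sizes `h n → 0`, whose difference quotients
converge to a densely defined operator `Z`. -/
structure ChernoffSystem (M b : ℝ) (h : ℕ → ℝ) (F : ℕ → X →L[𝕜] X) (Z : X →ₗ.[𝕜] X) : Prop where
  nonneg : 0 ≤ b
  pos : ∀ n, 0 < h n
  lim : Tendsto h atTop (𝓝 0)
  bound : ∀ n, PowBound M b (h n) (F n)
  dense : Dense (Z.domain : Set X)
  consistent : ∀ x : Z.domain, Tendsto (fun n => diffQuot (F n) (h n) x) atTop (𝓝 (Z x))

/-- `R` is the strong limit of the resolvents at `r` of the difference quotients. -/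
def IsResLim (h : ℕ → ℝ) (F : ℕ → X →L[𝕜] X) (r : ℝ) (R : X →L[𝕜] X) : Prop :=
  ∀ x, Tendsto (fun n => discRes (F n) (h n) r x) atTop (𝓝 (R x))

/-- The range of `r - Z` is dense. -/
def RangeDense (Z : X →ₗ.[𝕜] X) (r : ℝ) : Prop :=
  Dense (Set.range fun x : Z.domain => (r : 𝕜) • (x : X) - Z x)

theorem mem_graph_closure_iff_seq {Z : X →ₗ.[𝕜] X} {p : X × X} :
    p ∈ Z.graph.topologicalClosure ↔ ∃ u : ℕ → Z.domain,
      Tendsto (fun n => (u n : X)) atTop (𝓝 p.1) ∧ Tendsto (fun n => Z (u n)) atTop (𝓝 p.2) := by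
  rw [← SetLike.mem_coe, Submodule.topologicalClosure_coe, mem_closure_iff_seq_limit]
  constructor
  · rintro ⟨x, hx, hlim⟩
    choose u hu using fun n => (LinearPMap.mem_graph_iff Z).1 (hx n)
    refine ⟨u, ?_, ?_⟩
    · simpa [hu] using (Prod.tendsto_iff _ _).1 hlim |>.1
    · simpa [hu] using (Prod.tendsto_iff _ _).1 hlim |>.2
  · rintro ⟨u, h1, h2⟩
    exact ⟨fun n => (u n, Z (u n)), fun n => Z.mem_graph (u n),
      (Prod.tendsto_iff _ _).2 ⟨h1, h2⟩⟩

theorem ChernoffSystem.bound_nonneg {M b : ℝ} {h : ℕ → ℝ} {F : ℕ → X →L[𝕜] X} {Z : X →ₗ.[𝕜] X}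
    (S : ChernoffSystem M b h F Z) : 0 ≤ M := (S.bound 0).nonneg

variable [CompleteSpace X] {M b : ℝ} {h : ℕ → ℝ} {F : ℕ → X →L[𝕜] X} {Z : X →ₗ.[𝕜] X}

namespace ChernoffSystem

theorem norm_discRes_le (S : ChernoffSystem M b h F Z) {r : ℝ} (hr : b < r) (n : ℕ) :
    ‖discRes (F n) (h n) r‖ ≤ M / (r - b) :=
  Chernoff.norm_discRes_le (S.bound n) (S.pos n) S.nonneg hr

theorem tendsto_discRes_apply_sub (S : ChernoffSystem M b h F Z) {r : ℝ} (hr : b < r)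
    (x : Z.domain) :
    Tendsto (fun n => discRes (F n) (h n) r ((r : 𝕜) • (x : X) - Z x)) atTop (𝓝 (x : X)) := by
  have h0 : Tendsto (fun n => diffQuot (F n) (h n) x - Z x) atTop (𝓝 0) := by
    simpa using (S.consistent x).sub_const (Z x)
  have h1 := tendsto_apply_of_tendsto (l := atTop) (T := fun n => discRes (F n) (h n) r)
    (Eventually.of_forall fun n => S.norm_discRes_le hr n) h0 (y := 0) (by simp)
  have h2 := h1.add_const (x : X)
  rw [zero_add] at h2
  refine h2.congr fun n => ?_
  have h3 := DFunLike.congr_fun (discRes_mul (S.bound n) (S.pos n) S.nonneg hr) (x : X)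
  simp only [mul_apply_eq_comp, sub_apply, smul_apply, one_apply_eq_self] at h3
  nth_rw 2 [← h3]
  rw [← map_add]
  congr 1
  abel

theorem exists_isResLim (S : ChernoffSystem M b h F Z) {r : ℝ} (hr : b < r)
    (hd : RangeDense Z r) : ∃ R, IsResLim h F r R := by
  refine exists_tendsto_of_cauchySeq_on_dense (S.norm_discRes_le hr) hd ?_
  rintro _ ⟨x, rfl⟩
  exact (S.tendsto_discRes_apply_sub hr x).cauchySeq

variable {r r' : ℝ} {R R' : X →L[𝕜] X}

theorem resLim_apply_sub (S : ChernoffSystem M b h F Z) (hr : b < r) (hR : IsResLim h F r R)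
    (x : Z.domain) : R ((r : 𝕜) • (x : X) - Z x) = x :=
  tendsto_nhds_unique (hR _) (S.tendsto_discRes_apply_sub hr x)

theorem resLim_apply_sub_of_mem (S : ChernoffSystem M b h F Z) (hr : b < r)
    (hR : IsResLim h F r R) {p : X × X} (hp : p ∈ Z.graph.topologicalClosure) :
    R ((r : 𝕜) • p.1 - p.2) = p.1 := by
  obtain ⟨u, h1, h2⟩ := mem_graph_closure_iff_seq.1 hp
  refine tendsto_nhds_unique ?_ h1
  refine ((R.continuous.tendsto _).comp ((h1.const_smul (r : 𝕜)).sub h2)).congr fun n => ?_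
  exact S.resLim_apply_sub hr hR (u n)

theorem mem_of_resLim (S : ChernoffSystem M b h F Z) (hr : b < r)
    (hd : RangeDense Z r) (hR : IsResLim h F r R) (u : X) :
    (R u, (r : 𝕜) • R u - u) ∈ Z.graph.topologicalClosure := by
  obtain ⟨v, hv, hlim⟩ := mem_closure_iff_seq_limit.1 (hd u)
  choose x hx using hv
  have h1 : ∀ n, R (v n) = x n := fun n => by
    rw [← hx n]; exact S.resLim_apply_sub hr hR (x n)
  have h2 : Tendsto (fun n => (x n : X)) atTop (𝓝 (R u)) :=
    ((R.continuous.tendsto u).comp hlim).congr h1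
  refine mem_graph_closure_iff_seq.2 ⟨x, h2, ?_⟩
  refine ((h2.const_smul (r : 𝕜)).sub hlim).congr fun n => ?_
  rw [← hx n]
  simp

theorem tendsto_discRes_pow (S : ChernoffSystem M b h F Z) (hr : b < r) (hR : IsResLim h F r R)
    (j : ℕ) (x : X) :
    Tendsto (fun n => (discRes (F n) (h n) r ^ j) x) atTop (𝓝 ((R ^ j) x)) := by
  induction j with
  | zero => simp
  | succ j ih =>
    simp only [pow_succ', mul_apply_eq_comp]
    exact tendsto_apply_of_tendsto (l := atTop) (T := fun n => discRes (F n) (h n) r)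
      (Eventually.of_forall fun n => S.norm_discRes_le hr n) ih (hR _)

theorem norm_resLim_pow_le (S : ChernoffSystem M b h F Z) (hr : b < r) (hR : IsResLim h F r R)
    (j : ℕ) : ‖R ^ j‖ ≤ M / (r - b) ^ j :=
  norm_le_of_tendsto_apply (l := atTop) (T := fun n => discRes (F n) (h n) r ^ j)
    (Eventually.of_forall fun n => norm_discRes_pow_le (S.bound n) (S.pos n) S.nonneg hr j)
    tendsto_const_nhds (S.tendsto_discRes_pow hr hR j)

theorem norm_resLim_le (S : ChernoffSystem M b h F Z) (hr : b < r) (hR : IsResLim h F r R) :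
    ‖R‖ ≤ M / (r - b) := by
  simpa using S.norm_resLim_pow_le hr hR 1

theorem commute_resLim (S : ChernoffSystem M b h F Z) (hr : b < r) (hr' : b < r')
    (hR : IsResLim h F r R) (hR' : IsResLim h F r' R') : Commute R R' := by
  ext x
  have h1 : Tendsto (fun n => discRes (F n) (h n) r (discRes (F n) (h n) r' x)) atTop
      (𝓝 (R (R' x))) :=
    tendsto_apply_of_tendsto (l := atTop) (T := fun n => discRes (F n) (h n) r)
      (Eventually.of_forall fun n => S.norm_discRes_le hr n) (hR' x) (hR _)
  have h2 : Tendsto (fun n => discRes (F n) (h n) r' (discRes (F n) (h n) r x)) atTop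
      (𝓝 (R' (R x))) :=
    tendsto_apply_of_tendsto (l := atTop) (T := fun n => discRes (F n) (h n) r')
      (Eventually.of_forall fun n => S.norm_discRes_le hr' n) (hR x) (hR' _)
  refine tendsto_nhds_unique h1 (h2.congr fun n => ?_)
  have := commute_discRes_of_commute
    (commute_discRes_of_commute (Commute.refl (F n)) (h n) r).symm (h n) r'
  exact (DFunLike.congr_fun this.eq x).symm

theorem tendsto_smul_resLim (S : ChernoffSystem M b h F Z) {R : ℝ → X →L[𝕜] X}
    (hR : ∀ r > b, IsResLim h F r (R r)) (x : X) :
    Tendsto (fun m : ℝ => ((m : 𝕜) • R m) x) atTop (𝓝 x) := by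
  have hM := S.bound_nonneg
  have hb := S.nonneg
  have hbd : ∀ᶠ m : ℝ in atTop, ‖(m : 𝕜) • R m‖ ≤ 2 * M := by
    filter_upwards [eventually_gt_atTop (2 * b), eventually_gt_atTop 0] with m h1 h2
    have h3 : b < m := by linarith
    rw [norm_smul, norm_ofReal_of_nonneg 𝕜 h2.le]
    have h4 := S.norm_resLim_le h3 (hR m h3)
    rw [le_div_iff₀ (by linarith)] at h4
    nlinarith [norm_nonneg (R m)]
  have := tendsto_of_tendsto_on_dense (T₀ := (1 : X →L[𝕜] X)) hbd S.dense ?_ x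
  · simpa using this
  intro y hy
  have h1 : Tendsto (fun m : ℝ => M / (m - b) * ‖Z ⟨y, hy⟩‖) atTop (𝓝 0) := by
    rw [← zero_mul ‖Z ⟨y, hy⟩‖]
    exact (tendsto_const_nhds.div_atTop (tendsto_atTop_add_const_right _ _ tendsto_id)).mul_const _
  rw [tendsto_iff_norm_sub_tendsto_zero]
  refine squeeze_zero_norm' ?_ h1
  filter_upwards [eventually_gt_atTop b] with m hm
  have h2 := S.resLim_apply_sub hm (hR m hm) ⟨y, hy⟩
  rw [map_sub, map_smul, sub_eq_iff_eq_add] at h2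
  have h3 : ((m : 𝕜) • R m) y - (1 : X →L[𝕜] X) y = R m (Z ⟨y, hy⟩) := by
    rw [smul_apply, one_apply_eq_self, h2]
    simp
  rw [h3, norm_norm]
  exact norm_apply_le_of_norm_le (S.norm_resLim_le hm (hR m hm)) _

/-- Closability follows from density of the ranges. -/
theorem isClosable (S : ChernoffSystem M b h F Z) (hd : ∀ r > b, RangeDense Z r) :
    Z.IsClosable := by
  choose R hR using fun r : {r : ℝ // b < r} => S.exists_isResLim r.2 (hd r r.2)
  let R' : ℝ → X →L[𝕜] X := fun r => if hr : b < r then R ⟨r, hr⟩ else 0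
  have hR' : ∀ r > b, IsResLim h F r (R' r) := fun r hr => by
    simpa [R', hr] using hR ⟨r, hr⟩
  refine ⟨Z.graph.topologicalClosure.toLinearPMap, ?_⟩
  rw [Submodule.toLinearPMap_graph_eq]
  rintro ⟨x, y⟩ hp (rfl : x = 0)
  refine tendsto_nhds_unique (S.tendsto_smul_resLim hR' y) ?_
  refine tendsto_const_nhds.congr' ?_
  filter_upwards [eventually_gt_atTop b] with m hm
  have := S.resLim_apply_sub_of_mem hm (hR' m hm) hp
  simp only [smul_zero, zero_sub, map_neg, neg_eq_zero] at this
  simp [this]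

end ChernoffSystem

end System

theorem cauchySeq_of_forall_approx {E : Type*} [NormedAddCommGroup E] {a : ℕ → E}
    (h : ∀ ε > 0, ∃ c : ℕ → E, CauchySeq c ∧ ∀ᶠ n in atTop, ‖a n - c n‖ ≤ ε) : CauchySeq a := by
  rw [Metric.cauchySeq_iff]
  intro ε hε
  obtain ⟨c, hc, hac⟩ := h (ε / 4) (by positivity)
  obtain ⟨N, hN⟩ := Metric.cauchySeq_iff.1 hc (ε / 4) (by positivity)
  obtain ⟨N', hN'⟩ := eventually_atTop.1 hac
  refine ⟨max N N', fun m hm n hn => ?_⟩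
  have h1 := hN m (le_of_max_le_left hm) n (le_of_max_le_left hn)
  have h2 := hN' m (le_of_max_le_right hm)
  have h3 := hN' n (le_of_max_le_right hn)
  rw [← dist_eq_norm] at h2 h3
  have := dist_triangle4_right (a m) (a n) (c m) (c n)
  linarith

section System

variable {𝕜 : Type*} [RCLike 𝕜] {X : Type*} [NormedAddCommGroup X] [NormedSpace 𝕜 X]
  {M b : ℝ} {h : ℕ → ℝ} {F : ℕ → X →L[𝕜] X} {Z : X →ₗ.[𝕜] X}

theorem PowBound.norm_pow_le_exp {P : X →L[𝕜] X} {M b h T : ℝ} {k : ℕ} (hP : PowBound M b h P)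
    (hb : 0 ≤ b) (hh : 0 ≤ h) (hk : k * h ≤ T) : ‖P ^ k‖ ≤ M * Real.exp (b * T) := by
  refine (hP k).trans (mul_le_mul_of_nonneg_left ?_ hP.nonneg)
  calc (1 + b * h) ^ k ≤ Real.exp (b * h) ^ k := by
        gcongr
        rw [add_comm]
        exact Real.add_one_le_exp _
    _ = Real.exp (b * (k * h)) := by rw [← Real.exp_nat_mul]; ring_nf
    _ ≤ _ := by gcongr

theorem apply_eq_add_smul_diffQuot {P : X →L[𝕜] X} {h : ℝ} (hh : 0 < h) (x : X) :
    P x = x + (h : 𝕜) • diffQuot P h x := by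
  have : (h : 𝕜) ≠ 0 := by exact_mod_cast hh.ne'
  rw [diffQuot_apply, smul_smul, mul_inv_cancel₀ this, one_smul, add_sub_cancel]

theorem pow_apply_sub_eq_sum {P : X →L[𝕜] X} {h : ℝ} (hh : 0 < h) (k : ℕ) (x : X) :
    (P ^ k) x - x = (h : 𝕜) • ∑ i ∈ Finset.range k, (P ^ i) (diffQuot P h x) := by
  induction k with
  | zero => simp
  | succ k ih =>
    rw [Finset.sum_range_succ, smul_add, ← ih, pow_succ, mul_apply_eq_comp,
      apply_eq_add_smul_diffQuot hh x, map_add, map_smul]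
    abel

theorem norm_pow_add_sub_le {P : X →L[𝕜] X} {M b h T : ℝ} (hP : PowBound M b h P)
    (hb : 0 ≤ b) (hh : 0 < h) {k j : ℕ} (hk : (k + j : ℕ) * h ≤ T) (x : X) :
    ‖(P ^ (k + j)) x - (P ^ k) x‖ ≤ j * h * (M * Real.exp (b * T) * ‖diffQuot P h x‖) := by
  rw [pow_add, mul_apply_eq_comp, ← map_sub, pow_apply_sub_eq_sum hh, map_smul, norm_smul,
    norm_ofReal_of_nonneg 𝕜 hh.le, map_sum]
  have : ‖∑ i ∈ Finset.range j, (P ^ k) ((P ^ i) (diffQuot P h x))‖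
      ≤ ∑ i ∈ Finset.range j, M * Real.exp (b * T) * ‖diffQuot P h x‖ := by
    refine norm_sum_le_of_le _ fun i hi => ?_
    rw [← mul_apply_eq_comp, ← pow_add]
    refine norm_apply_le_of_norm_le (hP.norm_pow_le_exp hb hh.le (le_trans ?_ hk)) _
    have : k + i ≤ k + j := by have := Finset.mem_range.1 hi; omega
    gcongr
  rw [Finset.sum_const, Finset.card_range, nsmul_eq_mul] at this
  calc _ ≤ h * (j * (M * Real.exp (b * T) * ‖diffQuot P h x‖)) := by gcongr
    _ = _ := by ring

theorem norm_pow_sub_pow_le {P : X →L[𝕜] X} {M b h T : ℝ} (hP : PowBound M b h P)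
    (hb : 0 ≤ b) (hh : 0 < h) {k j : ℕ} (hk : k * h ≤ T) (hj : j * h ≤ T) (x : X) :
    ‖(P ^ k) x - (P ^ j) x‖ ≤ |k * h - j * h| * (M * Real.exp (b * T) * ‖diffQuot P h x‖) := by
  wlog hkj : j ≤ k generalizing k j
  · rw [norm_sub_rev, abs_sub_comm]
    exact this hj hk (le_of_not_ge hkj)
  obtain ⟨i, rfl⟩ := Nat.exists_eq_add_of_le hkj
  refine (norm_pow_add_sub_le hP hb hh hk x).trans (le_of_eq ?_)
  have : ((j + i : ℕ) : ℝ) * h - j * h = i * h := by push_cast; ring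
  rw [this, abs_of_nonneg (by positivity)]

theorem norm_resolvent_step_le [CompleteSpace X] {P B Q₀ : X →L[𝕜] X} {h r c T q : ℝ}
    (hP : PowBound M b h P) (hb : 0 ≤ b) (hh : 0 < h) (hr : b < r) (hQB : Commute Q₀ B)
    (hB : PowBound M c h (1 + (h : 𝕜) • B)) (hc : 0 ≤ c) {u : X} {k : ℕ} (hk : k * h ≤ T)
    (hq : ∀ j ≤ k, ‖(discRes P h r * ((r : 𝕜) • 1 - B) - 1 - Q₀)
      (((1 + (h : 𝕜) • B) ^ j) u)‖ ≤ q) :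
    ‖(P ^ k * discRes P h r - discRes P h r * (1 + (h : 𝕜) • B) ^ k) u‖
      ≤ T * (M * Real.exp (b * T) * (q + M * Real.exp (c * T) * ‖Q₀ u‖)) := by
  have hq0 : 0 ≤ q := (norm_nonneg _).trans (hq 0 (Nat.zero_le _))
  have hM := hP.nonneg
  have hstep : P * discRes P h r - discRes P h r * (1 + (h : 𝕜) • B)
      = (h : 𝕜) • (discRes P h r * ((r : 𝕜) • 1 - B) - 1) := by
    have h1 := mul_discRes hP hh hb hr
    have h2 : P = 1 + (h : 𝕜) • diffQuot P h := by
      ext x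
      exact apply_eq_add_smul_diffQuot hh x
    have h3 : diffQuot P h * discRes P h r = (r : 𝕜) • discRes P h r - 1 := by
      rw [sub_mul, smul_mul_assoc, one_mul, sub_eq_iff_eq_add] at h1
      rw [h1]; abel
    nth_rw 1 [h2]
    rw [add_mul, one_mul, smul_mul_assoc, h3, mul_add, mul_one, mul_smul_comm, mul_sub,
      mul_smul_comm, mul_one]
    simp only [smul_sub]
    abel
  have hQ : ∀ j : ℕ, Q₀ (((1 + (h : 𝕜) • B) ^ j : X →L[𝕜] X) u)
      = ((1 + (h : 𝕜) • B) ^ j : X →L[𝕜] X) (Q₀ u) := fun j => by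
    have : Commute Q₀ ((1 + (h : 𝕜) • B) ^ j) :=
      ((Commute.one_right Q₀).add_right (hQB.smul_right _)).pow_right j
    exact DFunLike.congr_fun this.eq u
  have hle : ∀ j ≤ k, (j : ℝ) * h ≤ T := fun j hj => le_trans (by gcongr) hk
  have hd : ∀ j < k, ‖(P * discRes P h r - discRes P h r * (1 + (h : 𝕜) • B))
      (((1 + (h : 𝕜) • B) ^ j) u)‖ ≤ h * (q + M * Real.exp (c * T) * ‖Q₀ u‖) := by
    intro j hj
    rw [hstep, smul_apply, norm_smul, norm_ofReal_of_nonneg 𝕜 hh.le]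
    gcongr
    have e : (discRes P h r * ((r : 𝕜) • 1 - B) - 1) (((1 + (h : 𝕜) • B) ^ j) u)
        = (discRes P h r * ((r : 𝕜) • 1 - B) - 1 - Q₀) (((1 + (h : 𝕜) • B) ^ j) u)
          + ((1 + (h : 𝕜) • B) ^ j) (Q₀ u) := by
      rw [← hQ, ← add_apply, sub_add_cancel]
    rw [e]
    refine (norm_add_le _ _).trans (add_le_add (hq j hj.le) ?_)
    exact norm_apply_le_of_norm_le (hB.norm_pow_le_exp hc hh.le (hle j hj.le)) _
  have := norm_pow_mul_sub_le (N := k)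
    (fun i hi => hP.norm_pow_le_exp hb hh.le (hle i hi)) hd k 0 (by simp)
  rw [pow_zero, one_mul] at this
  refine this.trans ?_
  calc _ = (k * h) * (M * Real.exp (b * T) * (q + M * Real.exp (c * T) * ‖Q₀ u‖)) := by ring
    _ ≤ _ := by gcongr

/-- `T s` is the strong limit of `F n ^ k n` whenever `k n * h n → s`. -/
def IsChernoffLimit (h : ℕ → ℝ) (F : ℕ → X →L[𝕜] X) (T : ℝ≥0 → X →L[𝕜] X) : Prop :=
  ∀ (s : ℝ≥0) (k : ℕ → ℕ), Tendsto (fun n => k n * h n) atTop (𝓝 (s : ℝ)) →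
    ∀ x, Tendsto (fun n => (F n ^ k n) x) atTop (𝓝 (T s x))

namespace ChernoffSystem

theorem floor_mul_le (S : ChernoffSystem M b h F Z) (s : ℝ≥0) (n : ℕ) :
    (⌊(s : ℝ) / h n⌋₊ : ℝ) * h n ≤ s := by
  have := Nat.floor_le (a := (s : ℝ) / h n) (div_nonneg s.2 (S.pos n).le)
  rwa [le_div_iff₀ (S.pos n)] at this

theorem tendsto_floor_mul (S : ChernoffSystem M b h F Z) (s : ℝ≥0) :
    Tendsto (fun n => (⌊(s : ℝ) / h n⌋₊ : ℝ) * h n) atTop (𝓝 (s : ℝ)) := by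
  have h1 : Tendsto (fun n => (s : ℝ) - h n) atTop (𝓝 s) := by
    simpa using S.lim.const_sub (s : ℝ)
  refine tendsto_of_tendsto_of_tendsto_of_le_of_le h1 tendsto_const_nhds (fun n => ?_)
    (S.floor_mul_le s)
  have := Nat.lt_floor_add_one ((s : ℝ) / h n)
  rw [div_lt_iff₀ (S.pos n)] at this
  simp only
  linarith

variable [CompleteSpace X] {r : ℝ}

theorem eventually_norm_pow_sub_le (S : ChernoffSystem M b h F Z) (hr : b < r) {R R' : X →L[𝕜] X}
    (hR : IsResLim h F r R) {m T : ℝ} (hm : 0 < m) (hbm : 2 * b ≤ m)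
    (hR' : IsResLim h F m R') {k : ℕ → ℕ} (hk : ∀ n, k n * h n ≤ T) (u : X) {ε : ℝ} (hε : 0 < ε) :
    ∀ᶠ n in atTop, ‖(F n ^ k n) (R u) - R (((1 + (h n : 𝕜) • yosida R' m) ^ k n) u)‖
      ≤ T * (M * Real.exp (b * T) * (M * Real.exp (2 * b * T)
        * ‖(R * ((r : 𝕜) • 1 - yosida R' m) - 1) u‖)) + ε := by
  have hb := S.nonneg
  have hM := S.bound_nonneg
  have hT : 0 ≤ T := le_trans (by have := S.pos 0; positivity) (hk 0)
  have hbm' : b < m := by rcases hb.eq_or_lt with h0 | h0 <;> linarith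
  set B := yosida R' m with hBdef
  set V : X →L[𝕜] X := (r : 𝕜) • 1 - B with hV
  set Q₀ : X →L[𝕜] X := R * V - 1 with hQ₀
  have hcomm : Commute R B :=
    ((S.commute_resLim hr hbm' hR hR').smul_right _).sub_right ((Commute.one_right R).smul_right _)
  have hcV : Commute V B := ((Commute.one_left B).smul_left _).sub_left (Commute.refl B)
  have hQB : Commute Q₀ B := (hcomm.mul_left hcV).sub_left (Commute.one_left B)
  have hnormR : ∀ n, ‖discRes (F n) (h n) r - R‖ ≤ 2 * (M / (r - b)) := fun n => by
    have h1 := S.norm_discRes_le hr n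
    have h2 := S.norm_resLim_le hr hR
    linarith [norm_sub_le (discRes (F n) (h n) r) R]
  have hlimR : ∀ x, Tendsto (fun n => (discRes (F n) (h n) r - R) x) atTop (𝓝 0) := fun x => by
    simpa using (hR x).sub_const (R x)
  have eQ : ∀ n, discRes (F n) (h n) r * V - 1 - Q₀ = (discRes (F n) (h n) r - R) * V := fun n => by
    rw [hQ₀, sub_mul]; abel
  have hnormQ : ∀ n, ‖discRes (F n) (h n) r * V - 1 - Q₀‖ ≤ 2 * (M / (r - b)) * ‖V‖ := fun n => by
    rw [eQ]
    exact (norm_mul_le _ _).trans (by gcongr; exact hnormR n)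
  have hlimQ : ∀ x, Tendsto (fun n => (discRes (F n) (h n) r * V - 1 - Q₀) x) atTop (𝓝 0) :=
    fun x => by simp_rw [eQ]; exact hlimR (V x)
  have l1 := tendsto_tsum_exp_weights (B := B) hT hnormR hlimR u
  have l2 := tendsto_tsum_exp_weights (B := B) hT hnormQ hlimQ u
  have l3 : Tendsto (fun n => ‖R u - discRes (F n) (h n) r u‖) atTop (𝓝 0) := by
    simpa using ((hR u).const_sub (R u)).norm
  have l4 := ((l3.const_mul (M * Real.exp (b * T))).add (((l2.add_const
    (M * Real.exp (2 * b * T) * ‖Q₀ u‖)).const_mul (M * Real.exp (b * T))).const_mul T)).add l1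
  simp only [mul_zero, zero_add, add_zero] at l4
  have l5 : Tendsto (fun n => h n * m) atTop (𝓝 0) := by simpa using S.lim.mul_const m
  filter_upwards [l4.eventually (gt_mem_nhds (lt_add_of_pos_right _ hε)),
    l5.eventually (gt_mem_nhds one_pos)] with n hn hnm
  refine le_trans ?_ hn.le
  have hB : PowBound M (2 * b) (h n) (1 + (h n : 𝕜) • B) :=
    powBound_one_add_smul_yosida hb hm hbm (S.pos n).le hnm.le
      (S.norm_resLim_pow_le hbm' hR')
  have hstep := norm_resolvent_step_le (Q₀ := Q₀) (S.bound n) hb (S.pos n) hr hQB hB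
    (by positivity) (u := u) (hk n)
    (q := ∑' i : ℕ, T ^ i / (i.factorial : ℝ) *
      ‖(discRes (F n) (h n) r * V - 1 - Q₀) ((B ^ i) u)‖)
    (fun j hj => norm_apply_one_add_smul_pow_le (S.pos n).le
      (le_trans (by have := S.pos n; gcongr) (hk n)) u)
  have h1 : ‖(F n ^ k n) (R u - discRes (F n) (h n) r u)‖
      ≤ M * Real.exp (b * T) * ‖R u - discRes (F n) (h n) r u‖ :=
    norm_apply_le_of_norm_le ((S.bound n).norm_pow_le_exp hb (S.pos n).le (hk n)) _
  have h2 := norm_apply_one_add_smul_pow_le (T := discRes (F n) (h n) r - R) (B := B)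
    (S.pos n).le (hk n) u
  have e : (F n ^ k n) (R u) - R (((1 + (h n : 𝕜) • B) ^ k n) u)
      = (F n ^ k n) (R u - discRes (F n) (h n) r u)
        + (F n ^ k n * discRes (F n) (h n) r
            - discRes (F n) (h n) r * (1 + (h n : 𝕜) • B) ^ k n) u
        + (discRes (F n) (h n) r - R) (((1 + (h n : 𝕜) • B) ^ k n) u) := by
    simp only [map_sub, sub_apply, mul_apply_eq_comp]
    abel
  rw [e]
  exact (norm_add₃_le).trans (add_le_add (add_le_add h1 hstep) h2)

theorem tendsto_yosida_defect (S : ChernoffSystem M b h F Z) {R : ℝ → X →L[𝕜] X}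
    (hd : ∀ r > b, RangeDense Z r) (hR : ∀ r > b, IsResLim h F r (R r)) (hr : b < r) (u : X) :
    Tendsto (fun m => ‖(R r * ((r : 𝕜) • 1 - yosida (R m) m) - 1) u‖) atTop (𝓝 0) := by
  set y := (r : 𝕜) • R r u - u with hy
  have h1 : Tendsto (fun m : ℝ => ‖y - ((m : 𝕜) • R m) y‖) atTop (𝓝 0) := by
    simpa using ((S.tendsto_smul_resLim hR y).const_sub y).norm
  refine h1.congr' ?_
  filter_upwards [eventually_gt_atTop b] with m hm
  have h2 := S.resLim_apply_sub_of_mem hm (hR m hm) (S.mem_of_resLim hr (hd r hr) (hR r hr) u)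
  change R m ((m : 𝕜) • R r u - y) = R r u at h2
  rw [map_sub, map_smul, sub_eq_iff_eq_add] at h2
  have h3 : R r (R m u) = R m (R r u) :=
    DFunLike.congr_fun (S.commute_resLim hr hm (hR r hr) (hR m hm)).eq u
  congr 1
  simp only [yosida, mul_apply_eq_comp, sub_apply, smul_apply, one_apply_eq_self, map_sub,
    map_smul, h3]
  have h4 : ((m ^ 2 : ℝ) : 𝕜) • R m (R r u) = (m : 𝕜) • R r u + (m : 𝕜) • R m y := by
    rw [← smul_add, ← h2, smul_smul]
    push_cast
    rw [sq]
  rw [h4]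
  abel_nf
  simp only [hy]
  abel

theorem cauchySeq_pow_apply (S : ChernoffSystem M b h F Z) (hd : ∀ r > b, RangeDense Z r)
    {k : ℕ → ℕ} {s : ℝ} (hk : Tendsto (fun n => k n * h n) atTop (𝓝 s)) (x : Z.domain) :
    CauchySeq fun n => (F n ^ k n) (x : X) := by
  choose R₀ hR₀ using fun r : {r : ℝ // b < r} => S.exists_isResLim r.2 (hd r r.2)
  let R : ℝ → X →L[𝕜] X := fun r => if hr : b < r then R₀ ⟨r, hr⟩ else 0
  have hR : ∀ r > b, IsResLim h F r (R r) := fun r hr => by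
    simpa [R, hr] using hR₀ ⟨r, hr⟩
  have hr : b < b + 1 := lt_add_one b
  obtain ⟨T, hT⟩ := hk.bddAbove_range
  have hT' : ∀ n, k n * h n ≤ T := fun n => hT ⟨n, rfl⟩
  set u := ((b + 1 : ℝ) : 𝕜) • (x : X) - Z x with hu
  have hx : R (b + 1) u = x := S.resLim_apply_sub hr (hR _ hr) x
  refine cauchySeq_of_forall_approx fun ε hε => ?_
  have h1 := (((S.tendsto_yosida_defect hd hR hr u).const_mul
    (M * Real.exp (2 * b * T))).const_mul (M * Real.exp (b * T))).const_mul T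
  simp only [mul_zero] at h1
  obtain ⟨m, hm, hm0, hmb⟩ := ((h1.eventually (gt_mem_nhds (half_pos hε))).and
    ((eventually_gt_atTop 0).and (eventually_gt_atTop (2 * b)))).exists
  have hbm : b < m := by linarith [S.nonneg]
  refine ⟨fun n => R (b + 1) (((1 + (h n : 𝕜) • yosida (R m) m) ^ k n) u), ?_, ?_⟩
  · obtain ⟨y, hy⟩ := tendsto_one_add_smul_pow (yosida (R m) m) (fun n => (S.pos n).le) S.lim hk u
    exact (((R (b + 1)).continuous.tendsto y).comp hy).cauchySeq
  · have := S.eventually_norm_pow_sub_le hr (hR _ hr) hm0 hmb.le (hR m hbm) hT' u (half_pos hε)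
    filter_upwards [this] with n hn
    rw [hx] at hn
    linarith

theorem exists_limit (S : ChernoffSystem M b h F Z) (hd : ∀ r > b, RangeDense Z r) :
    ∃ T : ℝ≥0 → X →L[𝕜] X, IsChernoffLimit h F T := by
  have hfloor := S.tendsto_floor_mul
  have hbdd : ∀ (k : ℕ → ℕ) (s : ℝ≥0), Tendsto (fun n => k n * h n) atTop (𝓝 (s : ℝ)) →
      ∃ T, ∀ n, k n * h n ≤ T := fun k s hk => by
    obtain ⟨T, hT⟩ := hk.bddAbove_range
    exact ⟨T, fun n => hT ⟨n, rfl⟩⟩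
  have hex : ∀ s : ℝ≥0, ∃ T : X →L[𝕜] X,
      ∀ x, Tendsto (fun n => (F n ^ ⌊(s : ℝ) / h n⌋₊) x) atTop (𝓝 (T x)) := by
    intro s
    obtain ⟨T, hT⟩ := hbdd _ s (hfloor s)
    exact exists_tendsto_of_cauchySeq_on_dense
      (fun n => (S.bound n).norm_pow_le_exp S.nonneg (S.pos n).le (hT n)) S.dense
      fun x hx => S.cauchySeq_pow_apply hd (hfloor s) ⟨x, hx⟩
  choose T hT using hex
  refine ⟨T, fun s k hk x => ?_⟩
  obtain ⟨a₁, ha₁⟩ := hbdd k s hk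
  obtain ⟨a₂, ha₂⟩ := hbdd _ s (hfloor s)
  refine tendsto_of_tendsto_on_dense (Eventually.of_forall fun n =>
    (S.bound n).norm_pow_le_exp S.nonneg (S.pos n).le (ha₁ n)) S.dense (fun y hy => ?_) x
  have h1 : Tendsto (fun n => |k n * h n - (⌊(s : ℝ) / h n⌋₊ : ℝ) * h n|
      * (M * Real.exp (b * max a₁ a₂) * ‖diffQuot (F n) (h n) y‖)) atTop (𝓝 0) := by
    have := ((hk.sub (hfloor s)).abs).mul
      ((S.consistent ⟨y, hy⟩).norm.const_mul (M * Real.exp (b * max a₁ a₂)))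
    simpa using this
  have h2 : Tendsto (fun n => (F n ^ k n) y - (F n ^ ⌊(s : ℝ) / h n⌋₊) y) atTop (𝓝 0) :=
    squeeze_zero_norm (fun n => norm_pow_sub_pow_le (S.bound n) S.nonneg (S.pos n)
      ((ha₁ n).trans (le_max_left _ _)) ((ha₂ n).trans (le_max_right _ _)) y) h1
  simpa using h2.add (hT s y)

end ChernoffSystem

end System

section System

variable {𝕜 : Type*} [RCLike 𝕜] {X : Type*} [NormedAddCommGroup X] [NormedSpace 𝕜 X]
  {M b : ℝ} {h : ℕ → ℝ} {F : ℕ → X →L[𝕜] X} {Z : X →ₗ.[𝕜] X} {T : ℝ≥0 → X →L[𝕜] X}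

theorem mem_graph_strongDeriv_iff {S : ℝ≥0 → X →L[𝕜] X} {x y : X} :
    (x, y) ∈ (strongDeriv S).graph ↔ HasStrongDerivAtZero S x y := by
  rw [LinearPMap.mem_graph_iff]
  constructor
  · rintro ⟨z, rfl, rfl⟩
    exact strongDeriv_spec S z
  · intro hy
    exact ⟨⟨x, y, hy⟩, rfl, (strongDeriv_spec S ⟨x, y, hy⟩).unique hy⟩

theorem norm_pow_sub_sub_smul_le {P : X →L[𝕜] X} {M b h s : ℝ} (hP : PowBound M b h P)
    (hb : 0 ≤ b) (hh : 0 < h) {k : ℕ} (hk : k * h ≤ s) (x y : X) :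
    ‖(P ^ k) x - x - ((k * h : ℝ) : 𝕜) • diffQuot P h x‖ ≤ k * h *
      ((M * Real.exp (b * s) + 1) * ‖diffQuot P h x - y‖
        + s * (M * Real.exp (b * s) * ‖diffQuot P h y‖)) := by
  have hM := hP.nonneg
  set a := diffQuot P h x with ha
  have e : (P ^ k) x - x - ((k * h : ℝ) : 𝕜) • a
      = (h : 𝕜) • ∑ i ∈ Finset.range k, ((P ^ i) a - a) := by
    rw [pow_apply_sub_eq_sum hh, Finset.sum_sub_distrib, Finset.sum_const, Finset.card_range,
      smul_sub, ← Nat.cast_smul_eq_nsmul 𝕜, smul_smul]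
    push_cast
    rw [mul_comm (k : 𝕜)]
  rw [e, norm_smul, norm_ofReal_of_nonneg 𝕜 hh.le]
  have hi : ∀ i ∈ Finset.range k, ‖(P ^ i) a - a‖ ≤ (M * Real.exp (b * s) + 1) * ‖a - y‖
        + s * (M * Real.exp (b * s) * ‖diffQuot P h y‖) := by
    intro i hi
    have his : (i : ℝ) * h ≤ s := by
      refine le_trans ?_ hk
      have := (Finset.mem_range.1 hi).le
      gcongr
    have h1 := norm_apply_le_of_norm_le (hP.norm_pow_le_exp hb hh.le his) (a - y)
    have h2 : ‖(P ^ i) y - y‖ ≤ s * (M * Real.exp (b * s) * ‖diffQuot P h y‖) := by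
      have := norm_pow_add_sub_le hP hb hh (k := 0) (j := i) (by simpa using his) y
      simp only [zero_add, pow_zero, one_apply_eq_self] at this
      exact this.trans (by gcongr)
    have e2 : (P ^ i) a - a = (P ^ i) (a - y) + ((P ^ i) y - y) - (a - y) := by
      rw [map_sub]; abel
    rw [e2]
    have h3 := norm_sub_le ((P ^ i) (a - y) + ((P ^ i) y - y)) (a - y)
    have h4 := norm_add_le ((P ^ i) (a - y)) ((P ^ i) y - y)
    linarith
  have := norm_sum_le_of_le _ hi
  rw [Finset.sum_const, Finset.card_range, nsmul_eq_mul] at this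
  calc _ ≤ h * (k * ((M * Real.exp (b * s) + 1) * ‖a - y‖
        + s * (M * Real.exp (b * s) * ‖diffQuot P h y‖))) := by gcongr
    _ = _ := by ring

theorem IsChernoffLimit.map_zero (hT : IsChernoffLimit h F T) : T 0 = 1 := by
  ext x
  refine tendsto_nhds_unique (hT 0 (fun _ => 0) (by simp) x) ?_
  simp

namespace ChernoffSystem

theorem tendsto_floor_pow (S : ChernoffSystem M b h F Z) (hT : IsChernoffLimit h F T) (s : ℝ≥0)
    (x : X) : Tendsto (fun n => (F n ^ ⌊(s : ℝ) / h n⌋₊) x) atTop (𝓝 (T s x)) :=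
  hT s _ (S.tendsto_floor_mul s) x

theorem norm_limit_le (S : ChernoffSystem M b h F Z) (hT : IsChernoffLimit h F T) (s : ℝ≥0) :
    ‖T s‖ ≤ M * Real.exp (b * s) :=
  norm_le_of_tendsto_apply (Eventually.of_forall fun n =>
    (S.bound n).norm_pow_le_exp S.nonneg (S.pos n).le (S.floor_mul_le s n))
    tendsto_const_nhds (S.tendsto_floor_pow hT s)

theorem limit_add (S : ChernoffSystem M b h F Z) (hT : IsChernoffLimit h F T) (l m : ℝ≥0) :
    T (l + m) = T l * T m := by
  ext x
  have h1 : Tendsto (fun n => ((⌊(l : ℝ) / h n⌋₊ + ⌊(m : ℝ) / h n⌋₊ : ℕ) : ℝ) * h n) atTop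
      (𝓝 ((l + m : ℝ≥0) : ℝ)) := by
    push_cast
    simp_rw [add_mul]
    exact (S.tendsto_floor_mul l).add (S.tendsto_floor_mul m)
  refine tendsto_nhds_unique (hT _ _ h1 x) ?_
  simp only [pow_add, mul_apply_eq_comp]
  exact tendsto_apply_of_tendsto (l := atTop) (T := fun n => F n ^ ⌊(l : ℝ) / h n⌋₊)
    (Eventually.of_forall fun n =>
      (S.bound n).norm_pow_le_exp S.nonneg (S.pos n).le (S.floor_mul_le l n))
    (S.tendsto_floor_pow hT m x) (S.tendsto_floor_pow hT l _)

theorem norm_limit_sub_le (S : ChernoffSystem M b h F Z) (hT : IsChernoffLimit h F T)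
    (x : Z.domain) (l m : ℝ≥0) : ‖T l x - T m x‖ ≤
      |(l : ℝ) - m| * (M * Real.exp (b * max (l : ℝ) m) * ‖Z x‖) := by
  refine le_of_tendsto_of_tendsto
    ((S.tendsto_floor_pow hT l x).sub (S.tendsto_floor_pow hT m x)).norm
    ((((S.tendsto_floor_mul l).sub (S.tendsto_floor_mul m)).abs).mul
      ((S.consistent x).norm.const_mul _)) (Eventually.of_forall fun n => ?_)
  exact norm_pow_sub_pow_le (S.bound n) S.nonneg (S.pos n)
    ((S.floor_mul_le l n).trans (le_max_left _ _)) ((S.floor_mul_le m n).trans (le_max_right _ _)) _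

theorem continuous_limit_apply (S : ChernoffSystem M b h F Z) (hT : IsChernoffLimit h F T)
    (x : X) : Continuous fun s => T s x := by
  have hb := S.nonneg
  have hM := S.bound_nonneg
  rw [continuous_iff_continuousAt]
  intro s
  have hnear : ∀ᶠ l : ℝ≥0 in 𝓝 s, (l : ℝ) ≤ s + 1 := by
    have : ∀ᶠ l : ℝ≥0 in 𝓝 s, l < s + 1 := gt_mem_nhds (lt_add_one s)
    filter_upwards [this] with l hl
    exact_mod_cast hl.le
  refine tendsto_of_tendsto_on_dense (C := M * Real.exp (b * (s + 1))) ?_ S.dense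
    (fun y hy => ?_) x
  · filter_upwards [hnear] with l hl
    exact (S.norm_limit_le hT l).trans (by gcongr)
  · rw [tendsto_iff_norm_sub_tendsto_zero]
    have h1 : Tendsto (fun l : ℝ≥0 => |(l : ℝ) - s| *
        (M * Real.exp (b * max (l : ℝ) s) * ‖Z ⟨y, hy⟩‖)) (𝓝 s) (𝓝 0) := by
      have : Continuous fun l : ℝ≥0 => |(l : ℝ) - s| *
        (M * Real.exp (b * max (l : ℝ) s) * ‖Z ⟨y, hy⟩‖) := by fun_prop
      simpa using this.tendsto s
    exact squeeze_zero (fun _ => norm_nonneg _)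
      (fun l => S.norm_limit_sub_le hT ⟨y, hy⟩ l s) h1

theorem isC0Semigroup (S : ChernoffSystem M b h F Z) (hT : IsChernoffLimit h F T) :
    IsC0Semigroup T where
  map_zero := hT.map_zero
  map_add := S.limit_add hT
  continuous_apply := S.continuous_limit_apply hT
  growth := by
    refine ⟨M + 2, b, by linarith [S.bound_nonneg], fun s => (S.norm_limit_le hT s).trans ?_⟩
    gcongr
    linarith

theorem norm_limit_sub_sub_smul_le (S : ChernoffSystem M b h F Z) (hT : IsChernoffLimit h F T)
    (x y : Z.domain) (s : ℝ≥0) :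
    ‖T s x - x - ((s : ℝ) : 𝕜) • Z x‖ ≤ s * ((M * Real.exp (b * s) + 1) * ‖Z x - y‖
      + s * (M * Real.exp (b * s) * ‖Z y‖)) := by
  have hcast := (RCLike.continuous_ofReal (K := 𝕜)).tendsto (s : ℝ)
  refine le_of_tendsto_of_tendsto
    (((S.tendsto_floor_pow hT s x).sub_const (x : X)).sub
      ((hcast.comp (S.tendsto_floor_mul s)).smul (S.consistent x))).norm
    ((S.tendsto_floor_mul s).mul ((((S.consistent x).sub_const (y : X)).norm.const_mul _).add
      (((S.consistent y).norm.const_mul _).const_mul _))) (Eventually.of_forall fun n => ?_)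
  exact norm_pow_sub_sub_smul_le (S.bound n) S.nonneg (S.pos n) (S.floor_mul_le s n) _ _

theorem hasStrongDerivAtZero_limit (S : ChernoffSystem M b h F Z) (hT : IsChernoffLimit h F T)
    {x y : X} (hxy : (x, y) ∈ Z.graph.topologicalClosure) : HasStrongDerivAtZero T x y := by
  have hb := S.nonneg
  have hM := S.bound_nonneg
  have key : ∀ (z : Z.domain) (s : ℝ≥0), ‖T s x - x - ((s : ℝ) : 𝕜) • y‖ ≤
      s * ((M * Real.exp (b * s) + 1) * ‖y - z‖ + s * (M * Real.exp (b * s) * ‖Z z‖)) := by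
    intro z s
    obtain ⟨u, h1, h2⟩ := mem_graph_closure_iff_seq.1 hxy
    exact le_of_tendsto_of_tendsto
      (((((T s).continuous.tendsto x).comp h1).sub h1).sub (h2.const_smul ((s : ℝ) : 𝕜))).norm
      ((((h2.sub_const (z : X)).norm.const_mul _).add_const _).const_mul _)
      (Eventually.of_forall fun n => S.norm_limit_sub_sub_smul_le hT (u n) z s)
  rw [HasStrongDerivAtZero, Metric.tendsto_nhds]
  intro ε hε
  have hC : 0 < M * Real.exp (b * 1) + 1 := by positivity
  obtain ⟨z, hz, hzD⟩ := Metric.dense_iff.1 S.dense y (ε / 2 / (M * Real.exp (b * 1) + 1))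
    (by positivity)
  rw [Metric.mem_ball, dist_comm, dist_eq_norm, lt_div_iff₀ hC] at hz
  have hlim : Tendsto (fun s : ℝ≥0 => (s : ℝ) * (M * Real.exp (b * 1) * ‖Z ⟨z, hzD⟩‖))
      (𝓝[>] 0) (𝓝 0) := by
    have : Continuous fun s : ℝ≥0 => (s : ℝ) * (M * Real.exp (b * 1) * ‖Z ⟨z, hzD⟩‖) := by
      fun_prop
    simpa using (this.tendsto 0).mono_left nhdsWithin_le_nhds
  have h1 : ∀ᶠ s : ℝ≥0 in 𝓝[>] 0, s < 1 := nhdsWithin_le_nhds (gt_mem_nhds one_pos)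
  filter_upwards [h1, self_mem_nhdsWithin, hlim.eventually (gt_mem_nhds (half_pos hε))]
    with s hs1 hs0 hs
  have hs0' : 0 < (s : ℝ) := by exact_mod_cast hs0
  have hs1' : (s : ℝ) ≤ 1 := by exact_mod_cast hs1.le
  have hne : ((s : ℝ) : 𝕜) ≠ 0 := by exact_mod_cast hs0'.ne'
  have e : (((s : ℝ) : 𝕜))⁻¹ • (T s x - T 0 x) - y
      = (((s : ℝ) : 𝕜))⁻¹ • (T s x - x - ((s : ℝ) : 𝕜) • y) := by
    rw [hT.map_zero, one_apply_eq_self, smul_sub _ (T s x - x), smul_smul, inv_mul_cancel₀ hne,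
      one_smul]
  rw [dist_eq_norm, e, norm_smul, norm_inv, norm_ofReal_of_nonneg 𝕜 hs0'.le,
    inv_mul_lt_iff₀ hs0']
  refine (key ⟨z, hzD⟩ s).trans_lt ?_
  gcongr
  have h2 : M * Real.exp (b * s) ≤ M * Real.exp (b * 1) := by gcongr
  have h3 : (M * Real.exp (b * s) + 1) * ‖y - z‖ ≤ (M * Real.exp (b * 1) + 1) * ‖y - z‖ := by
    gcongr
  have h4 : (s : ℝ) * (M * Real.exp (b * s) * ‖Z ⟨z, hzD⟩‖)
      ≤ s * (M * Real.exp (b * 1) * ‖Z ⟨z, hzD⟩‖) := by gcongr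
  simp only
  linarith

variable [CompleteSpace X]

theorem commute_resLim_limit (S : ChernoffSystem M b h F Z) (hT : IsChernoffLimit h F T) {r : ℝ}
    (hr : b < r) {R : X →L[𝕜] X} (hR : IsResLim h F r R) (s : ℝ≥0) : Commute R (T s) := by
  ext x
  have h1 : Tendsto (fun n => discRes (F n) (h n) r ((F n ^ ⌊(s : ℝ) / h n⌋₊) x)) atTop
      (𝓝 (R (T s x))) :=
    tendsto_apply_of_tendsto (l := atTop) (T := fun n => discRes (F n) (h n) r)
      (Eventually.of_forall fun n => S.norm_discRes_le hr n) (S.tendsto_floor_pow hT s x) (hR _)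
  have h2 : Tendsto (fun n => (F n ^ ⌊(s : ℝ) / h n⌋₊) (discRes (F n) (h n) r x)) atTop
      (𝓝 (T s (R x))) :=
    tendsto_apply_of_tendsto (l := atTop) (T := fun n => F n ^ ⌊(s : ℝ) / h n⌋₊)
      (Eventually.of_forall fun n =>
        (S.bound n).norm_pow_le_exp S.nonneg (S.pos n).le (S.floor_mul_le s n)) (hR x)
      (S.tendsto_floor_pow hT s _)
  refine tendsto_nhds_unique h1 (h2.congr fun n => ?_)
  have := commute_discRes_of_commute ((Commute.refl (F n)).pow_left ⌊(s : ℝ) / h n⌋₊) (h n) r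
  exact DFunLike.congr_fun this.eq x

theorem limit_mem_graph_closure (S : ChernoffSystem M b h F Z) (hT : IsChernoffLimit h F T)
    (hd : ∀ r > b, RangeDense Z r) (s : ℝ≥0) {p : X × X} (hp : p ∈ Z.graph.topologicalClosure) :
    (T s p.1, T s p.2) ∈ Z.graph.topologicalClosure := by
  have hr : b < b + 1 := lt_add_one b
  obtain ⟨R, hR⟩ := S.exists_isResLim hr (hd _ hr)
  have h1 := S.resLim_apply_sub_of_mem hr hR hp
  have h2 := S.mem_of_resLim hr (hd _ hr) hR (T s (((b + 1 : ℝ) : 𝕜) • p.1 - p.2))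
  have h3 : R (T s (((b + 1 : ℝ) : 𝕜) • p.1 - p.2)) = T s p.1 := by
    rw [← mul_apply_eq_comp, (S.commute_resLim_limit hT hr hR s).eq, mul_apply_eq_comp, h1]
  rw [h3, map_sub, map_smul, sub_sub_cancel] at h2
  exact h2

/-- The closure of `Z` generates the limit semigroup. -/
theorem closure_eq_strongDeriv (S : ChernoffSystem M b h F Z) (hT : IsChernoffLimit h F T)
    (hd : ∀ r > b, RangeDense Z r) : Z.closure = strongDeriv T := by
  refine LinearPMap.eq_of_eq_graph ?_
  rw [← (S.isClosable hd).graph_closure_eq_closure_graph]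
  ext ⟨x, y⟩
  rw [mem_graph_strongDeriv_iff]
  refine ⟨S.hasStrongDerivAtZero_limit hT, fun hxy => ?_⟩
  have hr : b < b + 1 := lt_add_one b
  obtain ⟨R, hR⟩ := S.exists_isResLim hr (hd _ hr)
  set r : 𝕜 := ((b + 1 : ℝ) : 𝕜) with hrdef
  have h1 : HasStrongDerivAtZero T (R x) (R y) := by
    refine ((R.continuous.tendsto y).comp hxy).congr fun s => ?_
    have hc : ∀ s, R (T s x) = T s (R x) := fun s =>
      DFunLike.congr_fun (S.commute_resLim_limit hT hr hR s).eq x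
    simp only [Function.comp_apply, map_smul, map_sub, hc]
  have h2 := S.hasStrongDerivAtZero_limit hT (S.mem_of_resLim hr (hd _ hr) hR x)
  have h3 : R y = r • R x - x := h1.unique h2
  have h4 := S.mem_of_resLim hr (hd _ hr) hR (r • x - y)
  have h5 : R (r • x - y) = x := by rw [map_sub, map_smul, h3, sub_sub_cancel]
  rw [h5, sub_sub_cancel] at h4
  exact h4

theorem isC0Generator_closure (S : ChernoffSystem M b h F Z) (hd : ∀ r > b, RangeDense Z r) :
    Z.IsClosable ∧ IsC0Generator Z.closure := by
  obtain ⟨T, hT⟩ := S.exists_limit hd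
  exact ⟨S.isClosable hd, T, S.isC0Semigroup hT, S.closure_eq_strongDeriv hT hd⟩

end ChernoffSystem

end System

section RangeDensity

variable {𝕜 : Type*} [RCLike 𝕜] {X : Type*} [NormedAddCommGroup X] [NormedSpace 𝕜 X]
  {Z : X →ₗ.[𝕜] X} {T : ℝ≥0 → X →L[𝕜] X}

theorem rangeDense_of_forall_dual (hZ : Dense (Z.domain : Set X)) {r : ℝ}
    (h : ∀ χ : StrongDual 𝕜 X, (∀ x : Z.domain, χ (Z x) = (r : 𝕜) * χ x) →
      ∀ x : Z.domain, χ x = 0) : RangeDense Z r := by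
  have hd : Dense (LinearMap.range ((r : 𝕜) • Z.domain.subtype - Z.toFun) : Set X) := by
    refine dense_of_forall_dual_eq_zero fun χ hχ => ?_
    have h0 := h χ fun x => by
      have := hχ _ ⟨x, rfl⟩
      simp only [LinearMap.sub_apply, LinearMap.smul_apply, Submodule.subtype_apply, map_sub,
        map_smul, smul_eq_mul, LinearPMap.toFun_eq_coe, sub_eq_zero] at this
      exact this.symm
    ext x
    exact congrFun (Continuous.ext_on hZ χ.continuous continuous_const
      (fun x hx => h0 ⟨x, hx⟩)) x
  exact hd

namespace IsC0Semigroup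

theorem hasStrongDerivAtZero_apply (hT : IsC0Semigroup T) {x y : X}
    (hxy : HasStrongDerivAtZero T x y) (s : ℝ≥0) : HasStrongDerivAtZero T (T s x) (T s y) := by
  refine (((T s).continuous.tendsto y).comp hxy).congr fun l => ?_
  have h1 : T s (T l x) = T l (T s x) := by
    rw [← mul_apply_eq_comp, ← hT.map_add, add_comm, hT.map_add, mul_apply_eq_comp]
  simp [h1, hT.map_zero]

theorem hasDerivWithinAt_dual (hT : IsC0Semigroup T) {x y : X}
    (hxy : HasStrongDerivAtZero T x y) (χ : StrongDual 𝕜 X) {s : ℝ} (hs : 0 ≤ s) :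
    HasDerivWithinAt (fun τ : ℝ => χ (T τ.toNNReal x)) (χ (T s.toNNReal y)) (Set.Ici s) s := by
  rw [hasDerivWithinAt_iff_tendsto_slope, Set.Ici_sdiff_left]
  have h1 : Tendsto (fun τ : ℝ => (τ - s).toNNReal) (𝓝[>] s) (𝓝[>] 0) := by
    refine tendsto_nhdsWithin_iff.2 ⟨?_, ?_⟩
    · have : Continuous fun τ : ℝ => (τ - s).toNNReal := by fun_prop
      simpa using (this.tendsto s).mono_left nhdsWithin_le_nhds
    · filter_upwards [self_mem_nhdsWithin] with τ hτ
      simpa using hτ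
  have h2 := (χ.continuous.tendsto _).comp ((hT.hasStrongDerivAtZero_apply hxy s.toNNReal).comp h1)
  refine h2.congr' ?_
  filter_upwards [self_mem_nhdsWithin] with τ hτ
  have hτ' : s < τ := hτ
  have e : T τ.toNNReal x = T (τ - s).toNNReal (T s.toNNReal x) := by
    rw [← mul_apply_eq_comp, ← hT.map_add, ← Real.toNNReal_add (by linarith) hs, sub_add_cancel]
  have hnn : (((τ - s).toNNReal : ℝ≥0) : ℝ) = τ - s := Real.coe_toNNReal _ (by linarith)
  simp only [Function.comp_apply, slope, vsub_eq_sub, e, hnn, hT.map_zero, one_apply_eq_self,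
    map_smul, map_sub, RCLike.real_smul_eq_coe_smul (K := 𝕜), RCLike.ofReal_inv]

/-- Functionals that are eigenvectors of the adjoint of the generator grow exponentially, so they
vanish when the eigenvalue exceeds the growth bound. -/
theorem dual_eq_zero (hT : IsC0Semigroup T) {M a r : ℝ}
    (hgrowth : ∀ s : ℝ≥0, ‖T s‖ ≤ M * Real.exp (a * s)) (har : a < r) (χ : StrongDual 𝕜 X)
    (hχ : ∀ x y, HasStrongDerivAtZero T x y → χ y = (r : 𝕜) * χ x) {x y : X}
    (hxy : HasStrongDerivAtZero T x y) : χ x = 0 := by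
  have hconst : ∀ τ : ℝ, 0 ≤ τ → Real.exp (-r * τ) • χ (T τ.toNNReal x) = χ x := by
    intro τ hτ
    have hq : Continuous fun τ : ℝ => χ (T τ.toNNReal x) :=
      χ.continuous.comp ((hT.continuous_apply x).comp continuous_real_toNNReal)
    have := constant_of_has_deriv_right_zero (a := 0) (b := τ)
      (f := fun τ => Real.exp (-r * τ) • χ (T τ.toNNReal x))
      (Continuous.continuousOn (Continuous.smul (by fun_prop) hq)) (fun s hs => ?_) τ ⟨hτ, le_rfl⟩
    · simpa [hT.map_zero] using this
    have h1 : HasDerivWithinAt (fun τ : ℝ => Real.exp (-r * τ)) (Real.exp (-r * s) * -r)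
        (Set.Ici s) s := by
      have : HasDerivAt (fun τ : ℝ => -r * τ) (-r) s := by
        simpa using (hasDerivAt_id s).const_mul (-r)
      exact this.exp.hasDerivWithinAt
    have h2 := h1.smul (hT.hasDerivWithinAt_dual hxy χ hs.1)
    refine (h2.congr_deriv ?_)
    rw [hχ _ _ (hT.hasStrongDerivAtZero_apply hxy s.toNNReal)]
    simp only [RCLike.real_smul_eq_coe_mul]
    push_cast
    ring
  have hlim : Tendsto (fun τ : ℝ => ‖χ‖ * M * ‖x‖ * Real.exp (-(r - a) * τ)) atTop (𝓝 0) := by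
    have h1 : Tendsto (fun τ : ℝ => -(r - a) * τ) atTop atBot :=
      tendsto_id.const_mul_atTop_of_neg (by linarith)
    simpa using (Real.tendsto_exp_atBot.comp h1).const_mul (‖χ‖ * M * ‖x‖)
  rw [← norm_le_zero_iff]
  refine ge_of_tendsto hlim ?_
  filter_upwards [eventually_ge_atTop 0] with τ hτ
  rw [← hconst τ hτ, norm_smul, Real.norm_of_nonneg (Real.exp_pos _).le]
  have h1 := norm_apply_le_of_norm_le (hgrowth τ.toNNReal) x
  rw [Real.coe_toNNReal _ hτ] at h1
  have h2 : ‖χ (T τ.toNNReal x)‖ ≤ ‖χ‖ * (M * Real.exp (a * τ) * ‖x‖) :=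
    (χ.le_opNorm _).trans (by gcongr)
  calc _ ≤ Real.exp (-r * τ) * (‖χ‖ * (M * Real.exp (a * τ) * ‖x‖)) := by gcongr
    _ = ‖χ‖ * M * ‖x‖ * (Real.exp (-r * τ) * Real.exp (a * τ)) := by ring
    _ = _ := by rw [← Real.exp_add]; ring_nf

end IsC0Semigroup

/-- If the closure of `Z` generates a semigroup, then `r - Z` has dense range for large `r`. -/
theorem rangeDense_of_isC0Generator (hZ : Dense (Z.domain : Set X)) (hcl : Z.IsClosable)
    (hgen : IsC0Generator Z.closure) : ∃ a : ℝ, ∀ r > a, RangeDense Z r := by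
  obtain ⟨T, hT, hZT⟩ := hgen
  obtain ⟨M, a, -, hgrowth⟩ := hT.growth
  have hgraph : ∀ x y, HasStrongDerivAtZero T x y ↔ (x, y) ∈ Z.graph.topologicalClosure := by
    intro x y
    rw [hcl.graph_closure_eq_closure_graph, hZT, mem_graph_strongDeriv_iff]
  refine ⟨a, fun r hr => rangeDense_of_forall_dual hZ fun χ hχ x => ?_⟩
  refine hT.dual_eq_zero hgrowth hr χ (fun x y hxy => ?_) (x := x) (y := Z x) ?_
  · obtain ⟨u, h1, h2⟩ := mem_graph_closure_iff_seq.1 ((hgraph x y).1 hxy)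
    refine tendsto_nhds_unique ((χ.continuous.tendsto y).comp h2) ?_
    refine (((χ.continuous.tendsto x).comp h1).const_mul (r : 𝕜)).congr fun n => ?_
    exact (hχ (u n)).symm
  · exact (hgraph _ _).2 (Z.graph.le_topologicalClosure (Z.mem_graph x))

end RangeDensity

section Weak

variable {𝕜 : Type*} [RCLike 𝕜] {X : Type*} [NormedAddCommGroup X] [NormedSpace 𝕜 X]

variable (𝕜) in
/-- Weak convergence of `u` to `x` along a filter, tested on functionals. -/
def WeakLim (L : Filter ℕ) (u : ℕ → X) (x : X) : Prop :=
  ∀ χ : StrongDual 𝕜 X, Tendsto (fun n => χ (u n)) L (𝓝 (χ x))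

theorem weaklyTendsto_iff {u : ℕ → X} {x : X} : WeaklyTendsto 𝕜 u x ↔ WeakLim 𝕜 atTop u x := by
  rw [WeaklyTendsto, WeakLim]
  exact WeakBilin.tendsto_iff_forall_eval_tendsto _
    (fun x y hxy => by
      rw [← sub_eq_zero, ← norm_le_zero_iff]
      refine NormedSpace.norm_le_dual_bound 𝕜 _ le_rfl fun f => ?_
      have := DFunLike.congr_fun hxy f
      simp only [LinearMap.flip_apply, topDualPairing_apply] at this
      simp [map_sub, this])

theorem WeakLim.add_of_norm_sub {L : Filter ℕ} {u v : ℕ → X} {x : X} (hu : WeakLim 𝕜 L u x)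
    (huv : Tendsto (fun n => ‖v n - u n‖) L (𝓝 0)) : WeakLim 𝕜 L v x := fun χ => by
  have h1 : Tendsto (fun n => χ (v n - u n)) L (𝓝 0) :=
    (χ.continuous.tendsto' 0 0 (map_zero χ)).comp
      (tendsto_zero_iff_norm_tendsto_zero.2 huv)
  simpa using h1.add (hu χ)

theorem WeakLim.unique {L : Filter ℕ} [L.NeBot] {u : ℕ → X} {x : X} (χ : StrongDual 𝕜 X)
    {y : 𝕜} (hu : WeakLim 𝕜 L u x) (hy : Tendsto (fun n => χ (u n)) L (𝓝 y)) : χ x = y :=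
  tendsto_nhds_unique (hu χ) hy

theorem WeakLim.norm_sub_le {L : Filter ℕ} [L.NeBot] {u v : ℕ → X} {x y : X} {ε : ℝ}
    (hε : 0 ≤ ε) (hu : WeakLim 𝕜 L u x) (hv : WeakLim 𝕜 L v y)
    (huv : ∀ᶠ n in L, ‖u n - v n‖ ≤ ε) : ‖x - y‖ ≤ ε := by
  refine NormedSpace.norm_le_dual_bound 𝕜 _ hε fun χ => ?_
  rw [map_sub]
  refine le_of_tendsto ((hu χ).sub (hv χ)).norm (huv.mono fun n hn => ?_)
  rw [← map_sub, mul_comm]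
  exact (χ.le_opNorm _).trans (by gcongr)

/-- A uniform limit of weakly convergent sequences is weakly convergent. -/
theorem exists_weakLim_of_approx [CompleteSpace X] {L : Filter ℕ} [L.NeBot] {z : ℕ → X}
    {y : ℕ → ℕ → X} {v : ℕ → X} {ε : ℕ → ℝ} (hε : ∀ j, 0 ≤ ε j) (hlim : Tendsto ε atTop (𝓝 0))
    (hy : ∀ j, WeakLim 𝕜 L (y j) (v j)) (hzy : ∀ j, ∀ᶠ n in L, ‖z n - y j n‖ ≤ ε j) :
    ∃ w, WeakLim 𝕜 L z w := by
  have hv : ∀ j k, ‖v j - v k‖ ≤ ε j + ε k := fun j k => by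
    refine (hy j).norm_sub_le (add_nonneg (hε j) (hε k)) (hy k) ?_
    filter_upwards [hzy j, hzy k] with n h1 h2
    have := norm_sub_le (z n - y k n) (z n - y j n)
    rw [sub_sub_sub_cancel_left] at this
    linarith
  have hc : CauchySeq v := by
    rw [Metric.cauchySeq_iff]
    intro δ hδ
    obtain ⟨N, hN⟩ := eventually_atTop.1 (hlim.eventually (gt_mem_nhds (half_pos hδ)))
    refine ⟨N, fun j hj k hk => ?_⟩
    rw [dist_eq_norm]
    linarith [hv j k, hN j hj, hN k hk]
  obtain ⟨w, hw⟩ := cauchySeq_tendsto_of_complete hc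
  have hvw : ∀ j, ‖v j - w‖ ≤ ε j := fun j =>
    le_of_tendsto_of_tendsto (hw.const_sub (v j)).norm
      (by simpa using hlim.const_add (ε j)) (Eventually.of_forall fun k => hv j k)
  refine ⟨w, fun χ => ?_⟩
  rw [Metric.tendsto_nhds]
  intro δ hδ
  have h1 : Tendsto (fun j => 2 * ‖χ‖ * ε j) atTop (𝓝 0) := by
    simpa using hlim.const_mul (2 * ‖χ‖)
  obtain ⟨j, hj⟩ := (h1.eventually (gt_mem_nhds (half_pos hδ))).exists
  filter_upwards [hzy j, Metric.tendsto_nhds.1 (hy j χ) (δ / 2) (half_pos hδ)] with n hn hn'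
  rw [dist_eq_norm] at hn' ⊢
  have e : χ (z n) - χ w = χ (z n - y j n) + (χ (y j n) - χ (v j)) + χ (v j - w) := by
    simp only [map_sub]; ring
  have h2 : ‖χ (z n - y j n)‖ ≤ ‖χ‖ * ε j := (χ.le_opNorm _).trans (by gcongr)
  have h3 : ‖χ (v j - w)‖ ≤ ‖χ‖ * ε j := (χ.le_opNorm _).trans (by gcongr; exact hvw j)
  rw [e]
  have h4 := norm_add₃_le (a := χ (z n - y j n)) (b := χ (y j n) - χ (v j)) (c := χ (v j - w))
  linarith

theorem WeaklySeqRelCompact.of_norm_sub {u v : ℕ → X} (hu : WeaklySeqRelCompact 𝕜 u)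
    (huv : Tendsto (fun n => ‖v n - u n‖) atTop (𝓝 0)) : WeaklySeqRelCompact 𝕜 v := by
  intro p hp
  obtain ⟨q, hq, x, hx⟩ := hu p hp
  refine ⟨q, hq, x, weaklyTendsto_iff.2 ?_⟩
  exact (weaklyTendsto_iff.1 hx).add_of_norm_sub
    (huv.comp (hp.tendsto_atTop.comp hq.tendsto_atTop))

theorem WeaklySeqRelCompact.comp_succ {u : ℕ → X} (hu : WeaklySeqRelCompact 𝕜 u) :
    WeaklySeqRelCompact 𝕜 fun n => u (n + 1) :=
  fun p hp => hu (fun k => p k + 1) fun _ _ hij => Nat.succ_lt_succ (hp hij)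

theorem weaklySeqRelCompact_of_tendsto {u : ℕ → X} {x : X} (hu : Tendsto u atTop (𝓝 x)) :
    WeaklySeqRelCompact 𝕜 u := by
  intro p hp
  refine ⟨id, strictMono_id, x, weaklyTendsto_iff.2 fun χ => ?_⟩
  exact (χ.continuous.tendsto x).comp (hu.comp hp.tendsto_atTop)

/-- Countably many relatively weakly compact sequences converge along a common filter. -/
theorem exists_filter_weakLim {y : ℕ → ℕ → X} (hy : ∀ j, WeaklySeqRelCompact 𝕜 (y j))
    {p : ℕ → ℕ} (hp : StrictMono p) :
    ∃ L : Filter ℕ, L.NeBot ∧ L ≤ map p atTop ∧ ∀ j, ∃ x, WeakLim 𝕜 L (y j) x := by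
  choose q hq x hx using hy
  let P : ℕ → {p : ℕ → ℕ // StrictMono p} := fun j =>
    Nat.rec ⟨p, hp⟩ (fun j p => ⟨p.1 ∘ q j p.1 p.2, p.2.comp (hq j p.1 p.2)⟩) j
  have hPsucc : ∀ j, (P (j + 1)).1 = (P j).1 ∘ q j (P j).1 (P j).2 := fun j => rfl
  have hanti : Antitone fun j => map (P j).1 atTop := by
    refine antitone_nat_of_succ_le fun j => ?_
    rw [hPsucc, ← map_map]
    exact map_mono (hq j _ _).tendsto_atTop
  refine ⟨⨅ j, map (P j).1 atTop, ?_, iInf_le (fun j => map (P j).1 atTop) 0, fun j => ?_⟩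
  · exact iInf_neBot_of_directed' hanti.directed_ge fun j => inferInstance
  · refine ⟨x j (P j).1 (P j).2, fun χ => ?_⟩
    have h1 : Tendsto (fun n => χ (y j n)) (map (P (j + 1)).1 atTop)
        (𝓝 (χ (x j (P j).1 (P j).2))) :=
      tendsto_map'_iff.2 (weaklyTendsto_iff.1 (hx j _ _) χ)
    exact h1.mono_left (iInf_le _ (j + 1))

end Weak

section Averages

open MeasureTheory

theorem integral_comp_floor_mul (d : ℕ → ℝ) {n : ℕ} (hn : 0 < n) (S : ℕ) :
    IntervalIntegrable (fun s : ℝ => d ⌊(n : ℝ) * s⌋₊) volume 0 S ∧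
    ∫ s in (0 : ℝ)..S, d ⌊(n : ℝ) * s⌋₊ = (n : ℝ)⁻¹ * ∑ k ∈ Finset.range (n * S), d k := by
  have hn' : (0 : ℝ) < n := by exact_mod_cast hn
  have hle : ∀ k : ℕ, (k : ℝ) / n ≤ ((k + 1 : ℕ) : ℝ) / n := fun k => by
    push_cast
    gcongr
    linarith
  have hcongr : ∀ k : ℕ, ∀ s ∈ Set.Ico ((k : ℝ) / n) (((k + 1 : ℕ) : ℝ) / n),
      d ⌊(n : ℝ) * s⌋₊ = d k := by
    intro k s hs
    congr 1
    rw [Nat.floor_eq_iff]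
    · have h1 := (div_le_iff₀ hn').1 hs.1
      have h2 := (lt_div_iff₀ hn').1 hs.2
      push_cast at h2
      exact ⟨by linarith, by linarith⟩
    · have : 0 ≤ s := le_trans (by positivity) hs.1
      positivity
  have hae : ∀ k : ℕ, (fun s : ℝ => d ⌊(n : ℝ) * s⌋₊)
      =ᵐ[volume.restrict (Set.uIoc ((k : ℝ) / n) (((k + 1 : ℕ) : ℝ) / n))] fun _ => d k := by
    intro k
    rw [Set.uIoc_of_le (hle k), Measure.restrict_congr_set Ico_ae_eq_Ioc.symm]
    exact (ae_restrict_iff' measurableSet_Ico).2 (Eventually.of_forall (hcongr k))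
  have hint : ∀ k : ℕ, IntervalIntegrable (fun s : ℝ => d ⌊(n : ℝ) * s⌋₊) volume
      ((k : ℝ) / n) (((k + 1 : ℕ) : ℝ) / n) := fun k =>
    (intervalIntegrable_const (c := d k)).congr_ae (hae k).symm
  have hend : (((n * S : ℕ) : ℝ) / n) = S := by
    push_cast
    field_simp
  have h0 : (((0 : ℕ) : ℝ) / n) = 0 := by simp
  constructor
  · have := IntervalIntegrable.trans_iterate (a := fun k : ℕ => (k : ℝ) / n) (n := n * S)
      fun k _ => hint k
    simpa only [hend, h0] using this
  · have := intervalIntegral.sum_integral_adjacent_intervals (a := fun k : ℕ => (k : ℝ) / n)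
      (n := n * S) fun k _ => hint k
    simp only [hend, h0] at this
    rw [← this, Finset.mul_sum]
    refine Finset.sum_congr rfl fun k _ => ?_
    rw [intervalIntegral.integral_congr_ae_restrict (hae k), intervalIntegral.integral_const]
    push_cast
    rw [smul_eq_mul]
    field_simp
    ring

/-- Dominated convergence for averages over a refining grid. -/
theorem tendsto_average_zero {d : ℕ → ℕ → ℝ} {C : ℝ} {S : ℕ}
    (hC : ∀ n k, k ≤ (n + 1) * S → ‖d n k‖ ≤ C)
    (h : ∀ s : ℝ≥0, Tendsto (fun n => d n ⌊((n + 1 : ℕ) : ℝ≥0) * s⌋₊) atTop (𝓝 0)) :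
    Tendsto (fun n => ((n + 1 : ℕ) : ℝ)⁻¹ * ∑ k ∈ Finset.range ((n + 1) * S), d n k)
      atTop (𝓝 0) := by
  have h1 : Tendsto (fun n => ∫ s in (0 : ℝ)..S, d n ⌊((n + 1 : ℕ) : ℝ) * s⌋₊) atTop
      (𝓝 (∫ s in (0 : ℝ)..S, (0 : ℝ))) := by
    refine intervalIntegral.tendsto_integral_filter_of_dominated_convergence (fun _ => C)
      (Eventually.of_forall fun n => ?_) (Eventually.of_forall fun n => ?_)
      intervalIntegrable_const ?_
    · have := (integral_comp_floor_mul (d n) n.succ_pos S).1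
      rw [intervalIntegrable_iff] at this
      exact this.aestronglyMeasurable
    · refine Eventually.of_forall fun s hs => hC n _ ?_
      rw [Set.uIoc_of_le (by positivity)] at hs
      refine Nat.floor_le_of_le ?_
      rw [Nat.cast_mul]
      have := hs.2
      gcongr
    · refine Eventually.of_forall fun s hs => ?_
      rw [Set.uIoc_of_le (by positivity)] at hs
      refine (h ⟨s, hs.1.le⟩).congr fun n => ?_
      congr 1
  rw [intervalIntegral.integral_zero] at h1
  refine h1.congr fun n => ?_
  exact (integral_comp_floor_mul (d n) n.succ_pos S).2

end Averages

section Converse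

variable {𝕜 : Type*} [RCLike 𝕜] {X : Type*} [NormedAddCommGroup X] [NormedSpace 𝕜 X]
  {M b : ℝ} {h : ℕ → ℝ} {F : ℕ → X →L[𝕜] X} {Z : X →ₗ.[𝕜] X}

theorem dual_telescope {P : X →L[𝕜] X} {h r : ℝ} (hh : 0 < h) (hr : 0 ≤ r)
    (χ : StrongDual 𝕜 X) (x : X) (K : ℕ) :
    χ x = (((1 + r * h)⁻¹ ^ K : ℝ) : 𝕜) * χ ((P ^ K) x) + (h : 𝕜) * ∑ k ∈ Finset.range K,
      (((1 + r * h)⁻¹ ^ (k + 1) : ℝ) : 𝕜) * χ ((P ^ k) ((r : 𝕜) • x - diffQuot P h x)) := by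
  induction K with
  | zero => simp
  | succ K ih =>
    rw [ih, Finset.sum_range_succ, mul_add (h : 𝕜), pow_succ P, mul_apply_eq_comp,
      apply_eq_add_smul_diffQuot (P := P) hh x]
    have h1 : ((1 + r * h : ℝ) : 𝕜) * (((1 + r * h)⁻¹ : ℝ) : 𝕜) = 1 := by
      rw [← RCLike.ofReal_mul, mul_inv_cancel₀ (by positivity), RCLike.ofReal_one]
    simp only [map_add, map_sub, map_smul, smul_eq_mul, pow_succ, RCLike.ofReal_mul]
    rw [RCLike.ofReal_add, RCLike.ofReal_one, RCLike.ofReal_mul] at h1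
    linear_combination (-((((1 + r * h)⁻¹ ^ K : ℝ) : 𝕜)) * χ ((P ^ K) x)) * h1

theorem norm_dual_le_of_powBound {P : X →L[𝕜] X} {h r t : ℝ} (hP : PowBound M b h P)
    (hb : 0 ≤ b) (hr : b < r) (hh : 0 < h) (ht : h ≤ t) (χ : StrongDual 𝕜 X) (x : X) (K : ℕ) :
    ‖χ x‖ ≤ M * ‖χ‖ * ‖x‖ * Real.exp (-((r - b) * (1 + r * t)⁻¹) * (K * h))
      + h * ∑ k ∈ Finset.range K, ‖χ ((P ^ k) ((r : 𝕜) • x - diffQuot P h x))‖ := by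
  have hr0 : 0 ≤ r := hb.trans hr.le
  have hM := hP.nonneg
  have ht0 : 0 < t := hh.trans_le ht
  have hc0 : 0 ≤ (1 + r * h)⁻¹ := by positivity
  have hc1 : (1 + r * h)⁻¹ ≤ 1 := inv_le_one_of_one_le₀ (by nlinarith)
  rw [dual_telescope (P := P) hh hr0 χ x K]
  refine (norm_add_le _ _).trans (add_le_add ?_ ?_)
  · rw [norm_mul, norm_ofReal_of_nonneg 𝕜 (by positivity)]
    have h1 : ‖χ ((P ^ K) x)‖ ≤ ‖χ‖ * (M * (1 + b * h) ^ K * ‖x‖) :=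
      (χ.le_opNorm _).trans (by gcongr; exact norm_apply_le_of_norm_le (hP K) x)
    have h2 : (1 + b * h) * (1 + r * h)⁻¹ ≤ Real.exp (-((r - b) * (1 + r * t)⁻¹) * h) := by
      have e : (1 + b * h) * (1 + r * h)⁻¹ = -((r - b) * (1 + r * h)⁻¹) * h + 1 := by
        have : (1 + r * h) * (1 + r * h)⁻¹ = 1 := mul_inv_cancel₀ (by positivity)
        linear_combination this
      rw [e]
      refine (Real.add_one_le_exp _).trans (Real.exp_le_exp.2 ?_)
      have h3 : (1 + r * t)⁻¹ ≤ (1 + r * h)⁻¹ := by gcongr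
      have h4 : 0 ≤ r - b := sub_nonneg.2 hr.le
      gcongr
    calc _ ≤ (1 + r * h)⁻¹ ^ K * (‖χ‖ * (M * (1 + b * h) ^ K * ‖x‖)) := by gcongr
      _ = M * ‖χ‖ * ‖x‖ * ((1 + b * h) * (1 + r * h)⁻¹) ^ K := by rw [mul_pow]; ring
      _ ≤ M * ‖χ‖ * ‖x‖ * Real.exp (-((r - b) * (1 + r * t)⁻¹) * h) ^ K := by gcongr
      _ = _ := by rw [← Real.exp_nat_mul]; ring_nf
  · rw [norm_mul, norm_ofReal_of_nonneg 𝕜 hh.le]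
    gcongr
    refine norm_sum_le_of_le _ fun k _ => ?_
    rw [norm_mul, norm_ofReal_of_nonneg 𝕜 (by positivity)]
    exact mul_le_of_le_one_left (norm_nonneg _) (pow_le_one₀ hc0 hc1)

namespace ChernoffSystem

/-- Along a fixed sequence of times, functionals that annihilate `r - Z` asymptotically annihilate
the discrete orbits of `Z f - r f`. -/
theorem tendsto_dual_pow_apply [CompleteSpace X] (S : ChernoffSystem M b h F Z)
    {D : Set (StrongDual 𝕜 X)} (hsep : ∀ v : X, (∀ φ ∈ D, φ v = 0) → v = 0)
    (hD : ∀ φ ∈ D, ∃ ψ : StrongDual 𝕜 X,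
      Tendsto (fun n => ((h n : 𝕜))⁻¹ • (φ.comp (F n) - φ)) atTop (𝓝 ψ))
    {A : Set X} (hA : Dense A) {N : ℕ → ℕ} {τ : ℝ} (hN : ∀ n, N n * h n ≤ τ)
    (happrox : ∀ f ∈ A, ∃ u : ℕ → Z.domain,
      Tendsto (fun n => ‖(F n ^ N n) f - u n‖) atTop (𝓝 0) ∧
      WeaklySeqRelCompact 𝕜 (fun n => Z (u n)) ∧ WeaklySeqRelCompact 𝕜 (fun n => (u n : X)))
    {r : ℝ} {χ : StrongDual 𝕜 X} (hχ : ∀ x : Z.domain, χ (Z x) = (r : 𝕜) * χ x)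
    (f : Z.domain) (hf : (f : X) ∈ A) :
    Tendsto (fun n => χ ((F n ^ N n) ((r : 𝕜) • (f : X) - diffQuot (F n) (h n) f)))
      atTop (𝓝 0) := by
  have hb := S.nonneg
  have hM := S.bound_nonneg
  set K := M * Real.exp (b * τ) with hK
  have hK0 : 0 ≤ K := by positivity
  have hbd : ∀ n, ‖F n ^ N n‖ ≤ K := fun n =>
    (S.bound n).norm_pow_le_exp hb (S.pos n).le (hN n)
  obtain ⟨g, hgA, hg⟩ := mem_closure_iff_seq_limit.1 (hA (Z f))
  obtain ⟨u, hu, huZ, huc⟩ := happrox f hf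
  have hwc : ∀ j, WeaklySeqRelCompact 𝕜 fun n => (F n ^ N n) (g j) := fun j => by
    obtain ⟨v, hv, -, hvc⟩ := happrox (g j) (hgA j)
    exact hvc.of_norm_sub hv
  rw [Metric.tendsto_nhds]
  by_contra hcon
  push Not at hcon
  obtain ⟨ε, hε, hfreq⟩ := hcon
  obtain ⟨p, hp, hpε⟩ := extraction_of_frequently_atTop hfreq
  let y : ℕ → ℕ → X := fun j => match j with
    | 0 => fun n => u n
    | 1 => fun n => Z (u n)
    | j + 2 => fun n => (F n ^ N n) (g j)
  obtain ⟨L, hL, hLp, hlim⟩ := exists_filter_weakLim (y := y) (fun j => match j with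
    | 0 => huc
    | 1 => huZ
    | j + 2 => hwc j) hp
  have hLtop : L ≤ atTop := hLp.trans hp.tendsto_atTop
  obtain ⟨x, hx⟩ := hlim 0
  obtain ⟨w, hw⟩ := hlim 1
  choose v hv using fun j => hlim (j + 2)
  change WeakLim 𝕜 L (fun n => (u n : X)) x at hx
  change WeakLim 𝕜 L (fun n => Z (u n)) w at hw
  have hx' : WeakLim 𝕜 L (fun n => (F n ^ N n) (f : X)) x := hx.add_of_norm_sub (hu.mono_left hLtop)
  have hgf : Tendsto (fun j => K * ‖Z f - g j‖) atTop (𝓝 0) := by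
    simpa using ((hg.const_sub (Z f)).norm).const_mul K
  obtain ⟨z, hz⟩ := exists_weakLim_of_approx (𝕜 := 𝕜) (z := fun n => (F n ^ N n) (Z f))
    (ε := fun j => K * ‖Z f - g j‖) (fun j => by positivity) hgf hv
    (fun j => Eventually.of_forall fun n => by
      change ‖(F n ^ N n) (Z f) - (F n ^ N n) (g j)‖ ≤ _
      rw [← map_sub]
      exact norm_apply_le_of_norm_le (hbd n) _)
  have hdiff : Tendsto (fun n => ‖(F n ^ N n) (diffQuot (F n) (h n) f) - (F n ^ N n) (Z f)‖)
      atTop (𝓝 0) := by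
    have h1 : Tendsto (fun n => K * ‖diffQuot (F n) (h n) f - Z f‖) atTop (𝓝 0) := by
      simpa using (((S.consistent f).sub_const (Z f)).norm).const_mul K
    refine squeeze_zero (fun _ => norm_nonneg _) (fun n => ?_) h1
    rw [← map_sub]
    exact norm_apply_le_of_norm_le (hbd n) _
  have hz' := hz.add_of_norm_sub (hdiff.mono_left hLtop)
  have hzw : z = w := by
    rw [← sub_eq_zero]
    refine hsep _ fun φ hφ => ?_
    obtain ⟨ψ, hψ⟩ := hD φ hφ
    have hdual : ∀ n (v : X), (((h n : 𝕜))⁻¹ • (φ.comp (F n) - φ)) v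
        = φ (diffQuot (F n) (h n) v) := fun n v => by
      simp [diffQuot_apply]
    have hψZ : ∀ v : Z.domain, φ (Z v) = ψ v := fun v => by
      refine tendsto_nhds_unique ((φ.continuous.tendsto _).comp (S.consistent v)) ?_
      refine (((ContinuousLinearMap.apply 𝕜 𝕜 (v : X)).continuous.tendsto ψ).comp hψ).congr
        fun n => ?_
      exact hdual n v
    have h1 : φ w = ψ x := hw.unique φ (by simpa only [hψZ] using hx ψ)
    have h2 : φ z = ψ x := by
      refine hz'.unique φ ?_
      have h3 : Tendsto (fun n => (((h n : 𝕜))⁻¹ • (φ.comp (F n) - φ) - ψ) ((F n ^ N n) (f : X))) L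
          (𝓝 0) := by
        have h4 : Tendsto (fun n => ‖((h n : 𝕜))⁻¹ • (φ.comp (F n) - φ) - ψ‖ * (K * ‖(f : X)‖))
            atTop (𝓝 0) := by
          simpa using ((hψ.sub_const ψ).norm).mul_const (K * ‖(f : X)‖)
        refine squeeze_zero_norm (fun n => ?_) (h4.mono_left hLtop)
        refine (ContinuousLinearMap.le_opNorm _ _).trans ?_
        gcongr
        exact norm_apply_le_of_norm_le (hbd n) _
      have h5 := h3.add (hx' ψ)
      rw [zero_add] at h5
      refine h5.congr fun n => ?_
      rw [sub_apply, sub_add_cancel, hdual]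
      congr 1
      have hc : Commute (diffQuot (F n) (h n)) (F n ^ N n) :=
        (((Commute.refl (F n)).sub_left (Commute.one_left _)).smul_left _).pow_right _
      exact DFunLike.congr_fun hc.eq (f : X)
    rw [map_sub, h1, h2, sub_self]
  have hxw : χ w = (r : 𝕜) * χ x := hw.unique χ (by simpa only [hχ] using (hx χ).const_mul (r : 𝕜))
  have hlast : Tendsto (fun n => χ ((F n ^ N n) ((r : 𝕜) • (f : X) - diffQuot (F n) (h n) f))) L
      (𝓝 0) := by
    have h1 := ((hx' χ).const_mul (r : 𝕜)).sub (hz' χ)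
    rw [hzw, hxw, sub_self] at h1
    refine h1.congr fun n => ?_
    simp only [map_sub, map_smul, smul_eq_mul]
  have hev : ∀ᶠ n in L, ¬ dist (χ ((F n ^ N n) ((r : 𝕜) • (f : X) - diffQuot (F n) (h n) f))) 0 < ε :=
    hLp (eventually_map.2 (Eventually.of_forall fun n => not_lt.2 (hpε n)))
  obtain ⟨n, hn1, hn2⟩ := (hev.and (Metric.tendsto_nhds.1 hlast ε hε)).exists
  exact hn1 hn2

theorem rangeDense_of_approx [CompleteSpace X] {t : ℝ} (ht : 0 < t)
    (S : ChernoffSystem M b (fun n => t / ((n + 1 : ℕ) : ℝ)) F Z)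
    {D : Set (StrongDual 𝕜 X)} (hsep : ∀ v : X, (∀ φ ∈ D, φ v = 0) → v = 0)
    (hD : ∀ φ ∈ D, ∃ ψ : StrongDual 𝕜 X, Tendsto (fun n : ℕ =>
      (((t / ((n + 1 : ℕ) : ℝ) : ℝ) : 𝕜))⁻¹ • (φ.comp (F n) - φ)) atTop (𝓝 ψ))
    {A : Set X} (hA : Dense A) (hAZ : ∀ f ∈ A, f ∈ Z.domain)
    (happrox : ∀ f ∈ A, ∀ s : ℝ≥0, ∃ u : ℕ → Z.domain,
      Tendsto (fun n => ‖(F n ^ ⌊((n + 1 : ℕ) : ℝ≥0) * s⌋₊) f - u n‖) atTop (𝓝 0) ∧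
      WeaklySeqRelCompact 𝕜 (fun n => Z (u n)) ∧ WeaklySeqRelCompact 𝕜 (fun n => (u n : X)))
    {r : ℝ} (hr : b < r) : RangeDense Z r := by
  have hb := S.nonneg
  have hM := S.bound_nonneg
  refine rangeDense_of_forall_dual S.dense fun χ hχ => ?_
  suffices hzero : ∀ f ∈ A, χ f = 0 from fun x =>
    congrFun (Continuous.ext_on hA χ.continuous continuous_const hzero) x
  intro f hf
  have hpt : ∀ s : ℝ≥0, Tendsto (fun n => ‖χ ((F n ^ ⌊((n + 1 : ℕ) : ℝ≥0) * s⌋₊)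
      ((r : 𝕜) • f - diffQuot (F n) (t / ((n + 1 : ℕ) : ℝ)) f))‖) atTop (𝓝 0) := by
    intro s
    have hN : ∀ n : ℕ, (⌊((n + 1 : ℕ) : ℝ≥0) * s⌋₊ : ℝ) * (t / ((n + 1 : ℕ) : ℝ)) ≤ s * t := by
      intro n
      have h1 : ((⌊((n + 1 : ℕ) : ℝ≥0) * s⌋₊ : ℝ≥0) : ℝ) ≤ (((n + 1 : ℕ) : ℝ≥0) * s : ℝ≥0) :=
        NNReal.coe_le_coe.2 (Nat.floor_le zero_le)
      rw [NNReal.coe_natCast, NNReal.coe_mul, NNReal.coe_natCast] at h1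
      have h2 : (0 : ℝ) < ((n + 1 : ℕ) : ℝ) := by positivity
      calc _ ≤ (((n + 1 : ℕ) : ℝ) * s) * (t / ((n + 1 : ℕ) : ℝ)) := by gcongr
        _ = _ := by field_simp
    have := S.tendsto_dual_pow_apply hsep hD hA hN (fun f hf => happrox f hf s) hχ ⟨f, hAZ f hf⟩ hf
    simpa using this.norm
  obtain ⟨C, hC⟩ := ((S.consistent ⟨f, hAZ f hf⟩).const_sub ((r : 𝕜) • f)).norm.bddAbove_range
  have hC' : ∀ n, ‖(r : 𝕜) • f - diffQuot (F n) (t / ((n + 1 : ℕ) : ℝ)) f‖ ≤ C :=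
    fun n => hC ⟨n, rfl⟩
  have hbound : ∀ J : ℕ, ‖χ f‖ ≤
      M * ‖χ‖ * ‖f‖ * Real.exp (-((r - b) * (1 + r * t)⁻¹) * (J * t)) := by
    intro J
    have hav := tendsto_average_zero (S := J) (C := ‖χ‖ * (M * Real.exp (b * (J * t)) * C))
      (d := fun n k => ‖χ ((F n ^ k) ((r : 𝕜) • f - diffQuot (F n) (t / ((n + 1 : ℕ) : ℝ)) f))‖)
      (fun n k hk => ?_) hpt
    · have hav' := (hav.const_mul t).const_add
        (M * ‖χ‖ * ‖f‖ * Real.exp (-((r - b) * (1 + r * t)⁻¹) * (J * t)))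
      rw [mul_zero, add_zero] at hav'
      refine ge_of_tendsto hav' (Eventually.of_forall fun n => ?_)
      have hn : (0 : ℝ) < ((n + 1 : ℕ) : ℝ) := by positivity
      have hle : t / ((n + 1 : ℕ) : ℝ) ≤ t := div_le_self ht.le (by simp)
      have := norm_dual_le_of_powBound (S.bound n) hb hr (S.pos n) hle χ f ((n + 1) * J)
      have e : (((n + 1) * J : ℕ) : ℝ) * (t / ((n + 1 : ℕ) : ℝ)) = J * t := by
        rw [Nat.cast_mul]; field_simp
      rw [e] at this
      rw [show ∀ a s : ℝ, t * (a⁻¹ * s) = t / a * s from fun a s => by ring]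
      exact this
    · rw [norm_norm]
      refine (χ.le_opNorm _).trans ?_
      gcongr
      refine (norm_apply_le_of_norm_le ((S.bound n).norm_pow_le_exp hb (S.pos n).le
        (T := J * t) ?_) _).trans (by gcongr; exact hC' n)
      have hn : (0 : ℝ) < ((n + 1 : ℕ) : ℝ) := by positivity
      calc (k : ℝ) * (t / ((n + 1 : ℕ) : ℝ))
          ≤ (((n + 1) * J : ℕ) : ℝ) * (t / ((n + 1 : ℕ) : ℝ)) := by gcongr
        _ = J * t := by rw [Nat.cast_mul]; field_simp
  have hδ : 0 < (r - b) * (1 + r * t)⁻¹ * t := by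
    have : 0 < r - b := sub_pos.2 hr
    have : 0 < r := hb.trans_lt hr
    positivity
  have hlim : Tendsto (fun J : ℕ => M * ‖χ‖ * ‖f‖ *
      Real.exp (-((r - b) * (1 + r * t)⁻¹) * (J * t))) atTop (𝓝 0) := by
    have h1 : Tendsto (fun J : ℕ => -((r - b) * (1 + r * t)⁻¹) * (J * t)) atTop atBot := by
      refine (tendsto_natCast_atTop_atTop.const_mul_atTop_of_neg (neg_lt_zero.2 hδ)).congr
        fun J => ?_
      ring
    simpa using (Real.tendsto_exp_atBot.comp h1).const_mul (M * ‖χ‖ * ‖f‖)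
  rw [← norm_le_zero_iff]
  exact ge_of_tendsto hlim (Eventually.of_forall hbound)

end ChernoffSystem

end Converse

variable {𝕜 : Type*} [RCLike 𝕜] {X : Type*} [NormedAddCommGroup X] [NormedSpace 𝕜 X]

theorem tendsto_div_succ_nhdsGT {t : ℝ≥0} (ht : 0 < t) :
    Tendsto (fun n : ℕ => t / ((n + 1 : ℕ) : ℝ≥0)) atTop (𝓝[>] 0) := by
  refine tendsto_nhdsWithin_iff.2 ⟨?_, Eventually.of_forall fun n => ?_⟩
  · rw [← NNReal.tendsto_coe]
    simp only [NNReal.coe_div, NNReal.coe_natCast, NNReal.coe_zero]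
    exact tendsto_const_nhds.div_atTop
      (tendsto_natCast_atTop_atTop.comp (tendsto_add_atTop_nat 1))
  · exact div_pos ht (by positivity)

theorem MemClassF.powBound {M a b : ℝ} {F : ℝ≥0 → X →L[𝕜] X} (hF : MemClassF M a F) (hM : 0 ≤ M)
    {t : ℝ≥0} (hb : |a| * Real.exp (|a| * t) ≤ b) (n : ℕ) :
    PowBound M b (t / ((n + 1 : ℕ) : ℝ)) (F (t / ((n + 1 : ℕ) : ℝ≥0))) := by
  intro k
  refine (hF.norm_pow_le (n + 1) k n.succ_pos t).trans ?_
  set l : ℝ := t / ((n + 1 : ℕ) : ℝ) with hl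
  have hl0 : 0 ≤ l := by positivity
  have hlt : l ≤ t := div_le_self t.2 (by simp)
  have h1 : a * k / ((n + 1 : ℕ) : ℝ) * t = k * (a * l) := by rw [hl]; ring
  have h2 : Real.exp (|a| * l) ≤ 1 + b * l := by
    have h3 : -(|a| * l) + 1 ≤ Real.exp (-(|a| * l)) := Real.add_one_le_exp _
    rw [Real.exp_neg] at h3
    have h4 := mul_le_mul_of_nonneg_right h3 (Real.exp_pos (|a| * l)).le
    rw [inv_mul_cancel₀ (Real.exp_pos _).ne'] at h4
    have h5 : |a| * Real.exp (|a| * l) ≤ b := le_trans (by gcongr) hb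
    have h6 := mul_le_mul_of_nonneg_right h5 hl0
    linarith
  rw [h1, Real.exp_nat_mul]
  gcongr
  refine le_trans (Real.exp_le_exp.2 ?_) h2
  gcongr
  exact le_abs_self a

theorem HasStrongDerivAtZero.tendsto_div_succ {S : ℝ≥0 → X →L[𝕜] X} {x y : X}
    (hxy : HasStrongDerivAtZero S x y) {t : ℝ≥0} (ht : 0 < t) :
    Tendsto (fun n : ℕ => ((((t : ℝ) / ((n + 1 : ℕ) : ℝ) : ℝ) : 𝕜))⁻¹ •
      (S (t / ((n + 1 : ℕ) : ℝ≥0)) x - S 0 x)) atTop (𝓝 y) :=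
  Tendsto.comp hxy (tendsto_div_succ_nhdsGT ht)

theorem MemClassF.chernoffSystem {M a b : ℝ} {F : ℝ≥0 → X →L[𝕜] X} (hF : MemClassF M a F)
    (hM : 0 ≤ M) {t : ℝ≥0} (ht : 0 < t) (hb : |a| * Real.exp (|a| * t) ≤ b) {Z : X →ₗ.[𝕜] X}
    (hZ : Dense (Z.domain : Set X)) (hZF : Z ≤ strongDeriv F) :
    ChernoffSystem M b (fun n => (t : ℝ) / ((n + 1 : ℕ) : ℝ))
      (fun n => F (t / ((n + 1 : ℕ) : ℝ≥0))) Z where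
  nonneg := le_trans (by positivity) hb
  pos n := div_pos ht (by positivity)
  lim := tendsto_const_nhds.div_atTop
    (tendsto_natCast_atTop_atTop.comp (tendsto_add_atTop_nat 1))
  bound := hF.powBound hM hb
  dense := hZ
  consistent x := by
    have hx : HasStrongDerivAtZero F x (Z x) :=
      mem_graph_strongDeriv_iff.1 (LinearPMap.le_graph_of_le hZF (Z.mem_graph x))
    refine (hx.tendsto_div_succ ht).congr fun n => ?_
    rw [hF.map_zero, diffQuot_apply, one_apply_eq_self]

theorem WeakStarDense.eq_zero {D : Set (StrongDual 𝕜 X)} (hD : WeakStarDense D) {v : X}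
    (hv : ∀ φ ∈ D, φ v = 0) : v = 0 := by
  rw [← norm_le_zero_iff]
  refine NormedSpace.norm_le_dual_bound 𝕜 v le_rfl fun φ => ?_
  have h1 : (fun ψ : WeakDual 𝕜 X => ψ v) = fun _ => 0 := by
    refine Continuous.ext_on hD (WeakDual.eval_continuous v) continuous_const ?_
    rintro _ ⟨ψ, hψ, rfl⟩
    exact hv ψ hψ
  have h2 : φ v = 0 := congrFun h1 (StrongDual.toWeakDual φ)
  simp [h2]

end Chernoff

theorem mainTheorem6 {𝕜 : Type*} [RCLike 𝕜]
    {X : Type*} [NormedAddCommGroup X] [NormedSpace 𝕜 X] [CompleteSpace X]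
    (Z : X →ₗ.[𝕜] X) (hZ : Dense (Z.domain : Set X))
    (t : ℝ≥0) (ht : 0 < t)
    (F : ℝ≥0 → X →L[𝕜] X) (hF : Chernoff.ClassF F)
    (hZF : Z ≤ Chernoff.strongDeriv F)
    (hFdual : Chernoff.WeakStarDense
      ((Chernoff.strongDeriv (Chernoff.dualFun F)).domain : Set (StrongDual 𝕜 X))) :
    (Z.IsClosable ∧ Chernoff.IsC0Generator Z.closure) ↔
      ∃ A : Submodule 𝕜 X, A ≤ Z.domain ∧ Dense (A : Set X) ∧
        ∀ f ∈ A, ∀ s : ℝ≥0, ∃ u : ℕ → Z.domain,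
          Tendsto (fun n : ℕ => ‖(F (t / (n : ℝ≥0)) ^ ⌊(n : ℝ≥0) * s⌋₊) f - (u n : X)‖)
            atTop (𝓝 0) ∧
          Chernoff.WeaklySeqRelCompact 𝕜 (fun n => Z (u n)) ∧
          Chernoff.WeaklySeqRelCompact 𝕜 (fun n => (u n : X)) := by
  obtain ⟨M, a, hM, hFM⟩ := hF
  have hM0 : 0 ≤ M := zero_le_one.trans hM
  constructor
  · rintro ⟨hcl, hgen⟩
    obtain ⟨a', ha'⟩ := Chernoff.rangeDense_of_isC0Generator hZ hcl hgen
    have S := hFM.chernoffSystem hM0 ht (le_max_left _ a') hZ hZF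
    have hd : ∀ r > max (|a| * Real.exp (|a| * t)) a', Chernoff.RangeDense Z r :=
      fun r hr => ha' r ((le_max_right _ _).trans_lt hr)
    obtain ⟨T, hT⟩ := S.exists_limit hd
    refine ⟨Z.domain, le_rfl, hZ, fun f hf s => ?_⟩
    obtain ⟨u, hu1, hu2⟩ := Chernoff.mem_graph_closure_iff_seq.1
      (S.limit_mem_graph_closure hT hd (t * s)
        (Z.graph.le_topologicalClosure (Z.mem_graph ⟨f, hf⟩)))
    refine ⟨fun n => u n, ?_, Chernoff.weaklySeqRelCompact_of_tendsto hu2,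
      Chernoff.weaklySeqRelCompact_of_tendsto hu1⟩
    rw [← tendsto_add_atTop_iff_nat 1]
    have hk : Tendsto (fun n : ℕ => (⌊((n + 1 : ℕ) : ℝ≥0) * s⌋₊ : ℝ) *
        ((t : ℝ) / ((n + 1 : ℕ) : ℝ))) atTop (𝓝 ((t * s : ℝ≥0) : ℝ)) := by
      have h1 : Tendsto (fun n : ℕ => (⌊(s : ℝ) * ((n + 1 : ℕ) : ℝ)⌋₊ : ℝ) / ((n + 1 : ℕ) : ℝ))
          atTop (𝓝 (s : ℝ)) :=
        (tendsto_nat_floor_mul_div_atTop s.2).comp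
          (tendsto_natCast_atTop_atTop.comp (tendsto_add_atTop_nat 1))
      rw [NNReal.coe_mul]
      refine (h1.const_mul (t : ℝ)).congr fun n => ?_
      have h2 : ⌊(s : ℝ) * ((n + 1 : ℕ) : ℝ)⌋₊ = ⌊((n + 1 : ℕ) : ℝ≥0) * s⌋₊ := by
        rw [mul_comm]
        rfl
      rw [h2]
      ring
    have h3 := (hT (t * s) _ hk f).sub (hu1.comp (tendsto_add_atTop_nat 1))
    simpa using h3.norm
  · rintro ⟨A, hAZ, hA, happrox⟩
    have S := hFM.chernoffSystem hM0 ht le_rfl hZ hZF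
    refine S.isC0Generator_closure fun r hr =>
      S.rangeDense_of_approx ht (fun v hv => hFdual.eq_zero hv) ?_ hA (fun f hf => hAZ hf) ?_ hr
    · rintro φ ⟨ψ, hψ⟩
      refine ⟨ψ, (hψ.tendsto_div_succ ht).congr fun n => ?_⟩
      congr 1
      ext x
      simp [Chernoff.dualFun_apply, hFM.map_zero]
    · intro f hf s
      obtain ⟨u, hu, huZ, huc⟩ := happrox f hf s
      exact ⟨fun n => u (n + 1), (tendsto_add_atTop_iff_nat 1).2 hu, huZ.comp_succ, huc.comp_succ⟩
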